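/- Let $\mathbb F$ be a field of characteristic $0$ with $(\mathbb F^\times)^2=\mathbb F^\times$. \emph{Conventions.} An associative algebra with involution over $\mathbb F$ is a unital associative $\mathbb F$-algebra with an $\mathbb F$-linear anti-automorphism $a\mapsto\bar a$ satisfying $\bar{\bar a}=a$. For an abelian group $L$, an \emph{associative $L$-torus with involution} $(\mathcal A,-)$ is a nonzero $L$-graded such algebra $\mathcal A=\bigoplus_{\sigma\in L}\mathcal A^\sigma$ whose involution preserves the grading and in which each $\mathcal A^\sigma$ is spanned by an invertible element. If $L$ is a subgroup of $\Gamma$ we set $\mathcal A^\sigma=0$ for $\sigma\in\Gamma\setminus L$. A $\Gamma$-graded hermitian form $\xi:X\times X\to\mathcal A$ consists of a right $\mathcal A$-module $X=\bigoplus_{\sigma\in\Gamma}X^\sigma$, graded by $\mathbb F$-subspaces with $X^\sigma.\mathcal A^\tau\subseteq X^{\sigma+\tau}$, and a bi-additive $\xi$ with $\xi(x.a,y)=\bar a\,\xi(x,y)$, $\xi(x,y.a)=\xi(x,y)a$, $\xi(y,x)=\overline{\xi(x,y)}$ and $\xi(X^\sigma,X^\tau)\subseteq\mathcal A^{\sigma+\tau}$.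 For a graded subspace $Y$ of $X$, $\operatorname{supp}Y=\{\sigma\in\Gamma: Y^\sigma\ne0\}$, where $Y^\sigma=Y\cap X^\sigma$. A \emph{Witt decomposition} is an orthogonal direct sum $X=X_{hyp}\perp X_{an}$ of graded submodules such that $\xi|_{X_{hyp}}$ is nondegenerate and $X_{hyp}=W_1\oplus W_2$ with $W_1,W_2$ totally isotropic graded submodules, and $\xi(x,x)\neq0$ for every nonzero homogeneous $x\in X_{an}$; the \emph{Witt index} is the cardinality of a homogeneous $\mathcal A$-basis of $W_1$ (equivalently, of $W_2$). \emph{Data.} Let $r\ge1$ be an integer, $\Gamma$ an abelian group without $2$-torsion, $L\le\Gamma$ a subgroup, $(\mathcal A,-)$ an associative $L$-torus with involution over $\mathbb F$, and $\xi:X\times X\to\mathcal A$ a nondegenerate $\Gamma$-graded hermitian form with all $\dim_{\mathbb F}X^\sigma$ finite and of Witt index $r$, such that $\operatorname{supp}X$ generates $\Gamma$ and such that for some Witt decomposition $X=X_{hyp}\perp X_{an}$: $\operatorname{supp}X_{hyp}=L$; $\xi(x,x)=1$ for some $x\in X_{an}^0$; and $\dim_{\mathbb F}X_{an}^\sigma\le1$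 for all $\sigma$. (Then $2\operatorname{supp}X:=\{2\sigma:\sigma\in\operatorname{supp}X\}\subseteq L$.) Choose a \emph{compatible basis}: a homogeneous $\mathcal A$-basis $\{x_i\}_{i\in J\sqcup K}$ of $X$ with $J=\{1,\dots,2r\}$ and a $k_0\in K$ such that, with $\bar\imath=2r+1-i$ for $i\in J$ and $\bar\imath=i$ for $i\in K$: $\xi(x_i,x_j)=\delta_{i\bar\jmath}\gamma_i$ with every $\gamma_i$ nonzero and homogeneous; $\deg x_i=0$ and $\gamma_i=1$ for $i\in J\cup\{k_0\}$; and $\bigl(\bigoplus_{i\in J}x_i.\mathcal A\bigr)\perp\bigl(\bigoplus_{i\in K}x_i.\mathcal A\bigr)$ is a Witt decomposition. For $x,y\in X$ let $U(x,y)\in\operatorname{End}_{\mathcal A}(X)$ be $z\mapsto x.\xi(y,z)-y.\xi(x,z)$. Let $\mathcal F$ be the Lie algebra $\operatorname{span}_{\mathbb F}\{U(x,y):x,y\in X\}$ (commutator product) and $\mathcal S=[\mathcal F,\mathcal F]$. Put $h_i=U(x_i,x_{\bar\imath})$ for $1\le i\le r$, let $\varepsilon_1,\dots,\varepsilon_r$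 be the basis dual to $h_1,\dots,h_r$, $Q=\bigoplus_{i=1}^r\mathbb Z\varepsilon_i$, and for $\mu=\sum_i\mu_i\varepsilon_i\in Q$ and $\sigma\in\Gamma$ let $X_\mu^\sigma=\{x\in X^\sigma: h_ix=\mu_ix\ (1\le i\le r)\}$. Then $\mathcal F$ and $\mathcal S$ are $(Q\times\Gamma)$-graded by $\mathcal F_\nu^\tau=\sum_{\lambda+\mu=\nu,\ \rho+\sigma=\tau}U(X_\lambda^\rho,X_\mu^\sigma)$ and $\mathcal S_\nu^\tau=\mathcal S\cap\mathcal F_\nu^\tau$. Let $\Gamma',L',(\mathcal A',-),\xi':X'\times X'\to\mathcal A'$, with the same $\mathbb F$ and $r$ and a compatible basis of $X'$, satisfy the same assumptions, and let $\mathcal F',\mathcal S'$ be the resulting $(Q'\times\Gamma')$-graded Lie algebras. Two such graded Lie algebras $\mathcal L,\mathcal L'$ are \emph{bi-isomorphic} if there are a Lie algebra isomorphism $\psi:\mathcal L\to\mathcal L'$ and group isomorphisms $\psi_r:Q\to Q'$, $\psi_e:\Gamma\to\Gamma'$ with $\psi(\mathcal L_\mu^\sigma)=\mathcal L'^{\,\psi_e(\sigma)}_{\psi_r(\mu)}$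 for all $\mu,\sigma$. An \emph{isograded isomorphism} of $(\mathcal A,-)$ onto $(\mathcal A',-)$ is an isomorphism $\varphi:\mathcal A\to\mathcal A'$ of algebras with involution together with a group isomorphism $\varphi_{gr}:L\to L'$ such that $\varphi(\mathcal A^\sigma)=\mathcal A'^{\varphi_{gr}(\sigma)}$ for $\sigma\in L$. \textbf{Claim.} (a) If there exists an isograded isomorphism $\varphi$ of $(\mathcal A,-)$ onto $(\mathcal A',-)$ with $\varphi_{gr}(2\operatorname{supp}X)=2\operatorname{supp}X'$, then $\mathcal F$ is bi-isomorphic to $\mathcal F'$ and $\mathcal S$ is bi-isomorphic to $\mathcal S'$. (b) Conversely, if $r\ge3$ and $\mathcal S$ and $\mathcal S'$ are bi-isomorphic, then there exists an isograded isomorphism $\varphi$ as in (a). -/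

import Mathlib

/-! Associative algebras are Lie algebras under the commutator product. -/

attribute [local instance 100] LieRing.ofAssociativeRing

noncomputable section

namespace UnitaryLie

open scoped RightActions

/-! ### Gradings -/

section Gradings

variable {F Γ X : Type*} [Field F] [AddCommGroup Γ] [AddCommGroup X] [Module F X]

open scoped Classical in
/-- The vector space `X` is the direct sum of the subspaces `𝓧 σ`. -/
def IsGrading {ι : Type*} (𝓧 : ι → Submodule F X) : Prop :=
  DirectSum.IsInternal 𝓧

/-- The support `{σ | X^σ ≠ 0}` of a graded vector space. -/
def supp {ι : Type*} (𝓧 : ι → Submodule F X) : Set ι :=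
  {σ | 𝓧 σ ≠ ⊥}

open scoped Classical in
/-- An `L`-graded space, `L` a subgroup of `Γ`, regarded as a `Γ`-graded space:
the components of degree outside `L` are zero. -/
def extendGrading {L : AddSubgroup Γ} (𝓧 : L → Submodule F X) :
    Γ → Submodule F X :=
  fun σ => if h : σ ∈ L then 𝓧 ⟨σ, h⟩ else ⊥

/-- The set `2 supp(X)`, as a subset of `L`. -/
def twiceSupp (L : AddSubgroup Γ) (𝓧 : Γ → Submodule F X) : Set L :=
  {a | ∃ σ ∈ supp 𝓧, (a : Γ) = 2 • σ}

end Gradings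

/-! ### Associative tori with involution -/

section Tori

variable {F A A' Λ Λ' : Type*} [Field F] [AddCommGroup Λ] [AddCommGroup Λ']
  [Ring A] [Algebra F A] [StarRing A] [Ring A'] [Algebra F A'] [StarRing A']

/-- `A`, with the family `𝒜` of subspaces and the involution `star`, is an associative `Λ`-torus
with involution over `F`: a `Λ`-graded associative algebra, each of whose homogeneous components
is spanned by an invertible element, with a graded `F`-linear involution. -/
structure IsTorusWithInvolution (𝒜 : Λ → Submodule F A) : Prop where
  nontrivial : Nontrivial A
  isGrading : IsGrading 𝒜
  mul_mem : ∀ σ τ : Λ, ∀ a ∈ 𝒜 σ, ∀ b ∈ 𝒜 τ, a * b ∈ 𝒜 (σ + τ)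
  spanned_by_unit : ∀ σ : Λ, ∃ u : Aˣ, 𝒜 σ = Submodule.span F {(u : A)}
  star_smul : ∀ (c : F) (a : A), star (c • a) = c • star a
  star_mem : ∀ σ : Λ, ∀ a ∈ 𝒜 σ, star a ∈ 𝒜 σ

/-- An isograded isomorphism `(φ, φ_gr)` of a `Λ`-graded algebra with involution onto a
`Λ'`-graded algebra with involution. -/
structure IsogradedIso (𝒜 : Λ → Submodule F A) (𝒜' : Λ' → Submodule F A') where
  toAlgEquiv : A ≃ₐ[F] A'
  gr : Λ ≃+ Λ'
  map_star : ∀ a : A, toAlgEquiv (star a) = star (toAlgEquiv a)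
  map_component : ∀ σ : Λ, (𝒜 σ).map toAlgEquiv.toLinearMap = 𝒜' (gr σ)

end Tori

/-! ### Hermitian forms -/

/-- A hermitian form on the right `A`-module `X` (right modules over `A` are modules over `Aᵐᵒᵖ`,
and `x <• a` is the right action). -/
structure HermitianForm (A X : Type*) [Ring A] [StarRing A] [AddCommGroup X] [Module Aᵐᵒᵖ X] where
  toFun : X → X → A
  add_left : ∀ x x' y, toFun (x + x') y = toFun x y + toFun x' y
  add_right : ∀ x y y', toFun x (y + y') = toFun x y + toFun x y'
  smul_left : ∀ (a : A) x y, toFun (x <• a) y = star a * toFun x y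
  smul_right : ∀ (a : A) x y, toFun x (y <• a) = toFun x y * a
  conj_symm : ∀ x y, toFun y x = star (toFun x y)

instance {A X : Type*} [Ring A] [StarRing A] [AddCommGroup X] [Module Aᵐᵒᵖ X] :
    CoeFun (HermitianForm A X) (fun _ => X → X → A) :=
  ⟨HermitianForm.toFun⟩

section Hermitian

variable {F A X : Type*} [Field F] [Ring A] [Algebra F A] [StarRing A]
  [AddCommGroup X] [Module F X] [Module Aᵐᵒᵖ X] [IsScalarTower F Aᵐᵒᵖ X]
  {Γ : Type*} [AddCommGroup Γ] {L : AddSubgroup Γ}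

/-- `ξ` is nondegenerate on the submodule `Y`. -/
def HermitianForm.NondegenerateOn (ξ : HermitianForm A X) (Y : Submodule Aᵐᵒᵖ X) : Prop :=
  ∀ x ∈ Y, (∀ y ∈ Y, ξ x y = 0) → x = 0

/-- `ξ` vanishes on the submodule `Y`. -/
def HermitianForm.TotallyIsotropic (ξ : HermitianForm A X) (Y : Submodule Aᵐᵒᵖ X) : Prop :=
  ∀ x ∈ Y, ∀ y ∈ Y, ξ x y = 0

/-- `X` is a `Γ`-graded module over the `L`-graded algebra `A`, and `ξ` is a `Γ`-graded form. -/
structure HermitianForm.IsGradedForm (ξ : HermitianForm A X) (𝒜 : L → Submodule F A)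
    (𝓧 : Γ → Submodule F X) : Prop where
  isGrading : IsGrading 𝓧
  smul_mem : ∀ (σ : Γ) (τ : L), ∀ x ∈ 𝓧 σ, ∀ a ∈ 𝒜 τ, x <• a ∈ 𝓧 (σ + τ)
  form_mem : ∀ σ τ : Γ, ∀ x ∈ 𝓧 σ, ∀ y ∈ 𝓧 τ, ξ x y ∈ extendGrading 𝒜 (σ + τ)

/-- The homogeneous component `Y^σ = Y ∩ X^σ` of a submodule `Y` of `X`. -/
def submoduleComponent (𝓧 : Γ → Submodule F X) (Y : Submodule Aᵐᵒᵖ X) (σ : Γ) : Submodule F X :=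
  Y.restrictScalars F ⊓ 𝓧 σ

/-- `Y` is a graded submodule of `X`: it is the sum of its homogeneous components. -/
def IsGradedSubmodule (𝓧 : Γ → Submodule F X) (Y : Submodule Aᵐᵒᵖ X) : Prop :=
  ⨆ σ, submoduleComponent 𝓧 Y σ = Y.restrictScalars F

/-- `Y` is the direct sum of the two totally isotropic graded submodules `W₁` and `W₂`. -/
structure HermitianForm.IsHyperbolicSplitting (ξ : HermitianForm A X) (𝓧 : Γ → Submodule F X)
    (Y W₁ W₂ : Submodule Aᵐᵒᵖ X) : Prop where
  disjoint : W₁ ⊓ W₂ = ⊥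
  sum_eq : W₁ ⊔ W₂ = Y
  graded₁ : IsGradedSubmodule 𝓧 W₁
  graded₂ : IsGradedSubmodule 𝓧 W₂
  isotropic₁ : ξ.TotallyIsotropic W₁
  isotropic₂ : ξ.TotallyIsotropic W₂

/-- The restriction of `ξ` to the graded submodule `Y` is hyperbolic. -/
def HermitianForm.HyperbolicOn (ξ : HermitianForm A X) (𝓧 : Γ → Submodule F X)
    (Y : Submodule Aᵐᵒᵖ X) : Prop :=
  ξ.NondegenerateOn Y ∧ ∃ W₁ W₂ : Submodule Aᵐᵒᵖ X, ξ.IsHyperbolicSplitting 𝓧 Y W₁ W₂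

/-- The restriction of `ξ` to the graded submodule `Y` is anisotropic (in the graded sense). -/
def HermitianForm.AnisotropicOn (ξ : HermitianForm A X) (𝓧 : Γ → Submodule F X)
    (Y : Submodule Aᵐᵒᵖ X) : Prop :=
  ∀ σ, ∀ x ∈ submoduleComponent 𝓧 Y σ, x ≠ 0 → ξ x x ≠ 0

/-- `X = X_hyp ⊥ X_an` is a Witt decomposition of `ξ`. -/
structure HermitianForm.IsWittDecomposition (ξ : HermitianForm A X) (𝓧 : Γ → Submodule F X)
    (Xhyp Xan : Submodule Aᵐᵒᵖ X) : Prop where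
  isCompl : IsCompl Xhyp Xan
  orthogonal : ∀ x ∈ Xhyp, ∀ y ∈ Xan, ξ x y = 0
  graded_hyp : IsGradedSubmodule 𝓧 Xhyp
  graded_an : IsGradedSubmodule 𝓧 Xan
  hyperbolic : ξ.HyperbolicOn 𝓧 Xhyp
  anisotropic : ξ.AnisotropicOn 𝓧 Xan

/-- The submodule `W` has rank `r` over `A`: it has a homogeneous `A`-basis with `r` elements. -/
def HasGradedRank (𝓧 : Γ → Submodule F X) (W : Submodule Aᵐᵒᵖ X) (r : ℕ) : Prop :=
  ∃ b : Module.Basis (Fin r) Aᵐᵒᵖ W, ∀ i, ∃ σ, (b i : X) ∈ 𝓧 σ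

/-- `ξ` has Witt index `r`: the hyperbolic part of a Witt decomposition of `ξ` is the direct sum
of two totally isotropic graded submodules of rank `r`. -/
def HermitianForm.HasWittIndex (ξ : HermitianForm A X) (𝓧 : Γ → Submodule F X) (r : ℕ) : Prop :=
  ∃ Xhyp Xan W₁ W₂ : Submodule Aᵐᵒᵖ X, ξ.IsWittDecomposition 𝓧 Xhyp Xan ∧
    ξ.IsHyperbolicSplitting 𝓧 Xhyp W₁ W₂ ∧ HasGradedRank 𝓧 W₁ r ∧ HasGradedRank 𝓧 W₂ r

/-- The standing assumptions under which a unitary Lie torus is constructed from `ξ`. -/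
structure UnitaryAssumptions (r : ℕ) (𝒜 : L → Submodule F A) (𝓧 : Γ → Submodule F X)
    (ξ : HermitianForm A X) : Prop where
  one_le : 1 ≤ r
  torus : IsTorusWithInvolution 𝒜
  graded : ξ.IsGradedForm 𝒜 𝓧
  nondegenerate : ξ.NondegenerateOn ⊤
  finite_graded_dim : ∀ σ, FiniteDimensional F (𝓧 σ)
  wittIndex : ξ.HasWittIndex 𝓧 r
  witt : ∃ Xhyp Xan : Submodule Aᵐᵒᵖ X, ξ.IsWittDecomposition 𝓧 Xhyp Xan ∧
    supp (submoduleComponent 𝓧 Xhyp) = (L : Set Γ) ∧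
    (∃ x ∈ submoduleComponent 𝓧 Xan 0, ξ x x = 1) ∧
    ∀ σ, Module.rank F (submoduleComponent 𝓧 Xan σ) ≤ 1
  full_support : AddSubgroup.closure (supp 𝓧) = ⊤

/-- The permutation `i ↦ ī` of the index set `{1, …, 2r} ⊔ K`: it is `i ↦ 2r + 1 - i` on
`{1, …, 2r}` (realised as `Fin (2 * r)`) and the identity on `K`. -/
def bar {r : ℕ} {K : Type*} : Fin (2 * r) ⊕ K → Fin (2 * r) ⊕ K :=
  Sum.map Fin.rev id

open scoped Classical in
/-- A compatible `A`-basis for `ξ`, indexed by `J ⊔ K` with `J = {1, …, 2r}`. -/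
structure CompatibleBasis (r : ℕ) (𝒜 : L → Submodule F A) (𝓧 : Γ → Submodule F X)
    (ξ : HermitianForm A X) (K : Type*) where
  basis : Module.Basis (Fin (2 * r) ⊕ K) Aᵐᵒᵖ X
  k₀ : K
  γ : Fin (2 * r) ⊕ K → A
  homogeneous : ∀ i, ∃ ρ, basis i ∈ 𝓧 ρ
  deg_hyp : ∀ j, basis (Sum.inl j) ∈ 𝓧 0
  deg_k₀ : basis (Sum.inr k₀) ∈ 𝓧 0
  form_eq : ∀ i j, ξ (basis i) (basis j) = if i = bar j then γ i else 0
  γ_ne_zero : ∀ i, γ i ≠ 0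
  γ_homogeneous : ∀ i, ∃ σ, γ i ∈ 𝒜 σ
  γ_hyp : ∀ j, γ (Sum.inl j) = 1
  γ_k₀ : γ (Sum.inr k₀) = 1
  witt : ξ.IsWittDecomposition 𝓧
    (Submodule.span Aᵐᵒᵖ (Set.range fun j => basis (Sum.inl j)))
    (Submodule.span Aᵐᵒᵖ (Set.range fun k => basis (Sum.inr k)))

/-! ### The unitary Lie algebras -/

/-- The endomorphism `E(x, y) : z ↦ x.ξ(y, z)` of the right `A`-module `X`. -/
def HermitianForm.E (ξ : HermitianForm A X) (x y : X) : Module.End Aᵐᵒᵖ X where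
  toFun z := x <• ξ y z
  map_add' z w := by rw [ξ.add_right, MulOpposite.op_add, add_smul]
  map_smul' a z := by
    have h : a • z = z <• a.unop := rfl
    rw [h, ξ.smul_right, MulOpposite.op_mul, mul_smul]; rfl

/-- `U(x, y) = E(x, y) - E(y, x)`. -/
def HermitianForm.U (ξ : HermitianForm A X) (x y : X) : Module.End Aᵐᵒᵖ X :=
  ξ.E x y - ξ.E y x

theorem HermitianForm.E_apply (ξ : HermitianForm A X) (x y z : X) :
    ξ.E x y z = x <• ξ y z := rfl

theorem HermitianForm.U_apply (ξ : HermitianForm A X) (x y z : X) :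
    ξ.U x y z = x <• ξ y z - y <• ξ x z := rfl

theorem HermitianForm.sub_right (ξ : HermitianForm A X) (x y y' : X) :
    ξ x (y - y') = ξ x y - ξ x y' := by
  have h := ξ.add_right x (y - y') y'
  rw [sub_add_cancel] at h
  rw [h, add_sub_cancel_right]

theorem HermitianForm.sub_left (ξ : HermitianForm A X) (x x' y : X) :
    ξ (x - x') y = ξ x y - ξ x' y := by
  have h := ξ.add_left (x - x') x' y
  rw [sub_add_cancel] at h
  rw [h, add_sub_cancel_right]

theorem HermitianForm.bracket_U (ξ : HermitianForm A X) (x y z w : X) :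
    ⁅ξ.U x y, ξ.U z w⁆ = ξ.U (ξ.U x y z) w + ξ.U z (ξ.U x y w) := by
  ext v
  simp only [LieRing.of_associative_ring_bracket, LinearMap.sub_apply, Module.End.mul_apply,
    LinearMap.add_apply, HermitianForm.U_apply, ξ.sub_right, ξ.sub_left, ξ.smul_left,
    ξ.smul_right, MulOpposite.op_sub, MulOpposite.op_mul, sub_smul, mul_smul, smul_sub,
    ← ξ.conj_symm]
  abel

variable (F) in
/-- The finite unitary Lie algebra `𝔣𝔲(X, ξ)`: the `F`-span of the `U(x, y)`, a Lie subalgebra of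
`𝔤𝔩_A(X)`. -/
def finiteUnitary (ξ : HermitianForm A X) : LieSubalgebra F (Module.End Aᵐᵒᵖ X) where
  toSubmodule := Submodule.span F {T | ∃ x y, T = ξ.U x y}
  lie_mem' := by
    intro S T hS hT
    change S ∈ Submodule.span F _ at hS
    change T ∈ Submodule.span F _ at hT
    change ⁅S, T⁆ ∈ Submodule.span F _
    induction hS using Submodule.span_induction with
    | zero => rw [zero_lie]; exact zero_mem _
    | add a b _ _ ha hb => rw [add_lie]; exact add_mem ha hb
    | smul c a _ ha => rw [smul_lie]; exact Submodule.smul_mem _ c ha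
    | mem S hS =>
      obtain ⟨x, y, rfl⟩ := hS
      induction hT using Submodule.span_induction with
      | zero => rw [lie_zero]; exact zero_mem _
      | add a b _ _ ha hb => rw [lie_add]; exact add_mem ha hb
      | smul c a _ ha => rw [lie_smul]; exact Submodule.smul_mem _ c ha
      | mem T hT =>
        obtain ⟨z, w, rfl⟩ := hT
        rw [ξ.bracket_U]
        exact add_mem (Submodule.subset_span ⟨_, _, rfl⟩) (Submodule.subset_span ⟨_, _, rfl⟩)

variable (F) in
/-- The special unitary Lie algebra `𝔰𝔲(X, ξ)`: the derived algebra of `𝔣𝔲(X, ξ)`. -/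
def specialUnitary (ξ : HermitianForm A X) : LieSubalgebra F (Module.End Aᵐᵒᵖ X) where
  toSubmodule := Submodule.span F
    {R | ∃ S ∈ finiteUnitary F ξ, ∃ T ∈ finiteUnitary F ξ, R = ⁅S, T⁆}
  lie_mem' := by
    have key : Submodule.span F
        {R | ∃ S ∈ finiteUnitary F ξ, ∃ T ∈ finiteUnitary F ξ, R = ⁅S, T⁆} ≤
        (finiteUnitary F ξ).toSubmodule := by
      rw [Submodule.span_le]
      rintro _ ⟨S, hS, T, hT, rfl⟩
      exact (finiteUnitary F ξ).lie_mem hS hT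
    intro S T hS hT
    exact Submodule.subset_span ⟨S, key hS, T, key hT, rfl⟩

/-! ### The gradings by `Q × Γ` -/

section BiGrading

variable {r : ℕ} {𝒜 : L → Submodule F A} {𝓧 : Γ → Submodule F X} {ξ : HermitianForm A X}
  {K : Type*}

/-- `h_i = U(x_i, x_ī)` for `1 ≤ i ≤ r`. -/
def CompatibleBasis.h (B : CompatibleBasis r 𝒜 𝓧 ξ K) (i : Fin r) : Module.End Aᵐᵒᵖ X :=
  let j : Fin (2 * r) ⊕ K := Sum.inl (Fin.castLE (by omega) i)
  ξ.U (B.basis j) (B.basis (bar j))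

/-- The root lattice `Q = ℤ ε_1 ⊕ ⋯ ⊕ ℤ ε_r`, where `ε_1, …, ε_r` is the basis dual to
`h_1, …, h_r`; the vector `μ` of integers stands for `∑ μ_i ε_i`. -/
abbrev RootLattice (r : ℕ) : Type := Fin r → ℤ

/-- The weight space `X_μ = {x | h x = μ(h) x for all h in the span of h_1, …, h_r}`. -/
def CompatibleBasis.weightSpace (B : CompatibleBasis r 𝒜 𝓧 ξ K) (μ : RootLattice r) :
    Submodule F X where
  carrier := {x | ∀ i, B.h i x = μ i • x}
  zero_mem' i := by simp
  add_mem' hx hy i := by rw [map_add, hx i, hy i, smul_add]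
  smul_mem' c x hx i := by rw [LinearMap.map_smul_of_tower, hx i, smul_comm]

/-- The space `∑_{λ + μ = ν} ∑_{ρ + σ = τ} U(X_λ^ρ, X_μ^σ)`, where `X_λ^ρ = X_λ ∩ X^ρ`. -/
def CompatibleBasis.component (B : CompatibleBasis r 𝒜 𝓧 ξ K) (ν : RootLattice r) (τ : Γ) :
    Submodule F (Module.End Aᵐᵒᵖ X) :=
  Submodule.span F {T | ∃ (lam μ : RootLattice r) (ρ σ : Γ) (x y : X),
    lam + μ = ν ∧ ρ + σ = τ ∧ x ∈ B.weightSpace lam ⊓ 𝓧 ρ ∧ y ∈ B.weightSpace μ ⊓ 𝓧 σ ∧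
      T = ξ.U x y}

/-- The `(Q × Γ)`-grading of `𝔣𝔲(X, ξ)` defined by a compatible basis. -/
def CompatibleBasis.finiteUnitaryGrading (B : CompatibleBasis r 𝒜 𝓧 ξ K) :
    RootLattice r → Γ → Submodule F (finiteUnitary F ξ) :=
  fun ν τ => (B.component ν τ).comap (finiteUnitary F ξ).toSubmodule.subtype

/-- The `(Q × Γ)`-grading of `𝔰𝔲(X, ξ)` as a graded subalgebra of `𝔣𝔲(X, ξ)`. -/
def CompatibleBasis.specialUnitaryGrading (B : CompatibleBasis r 𝒜 𝓧 ξ K) :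
    RootLattice r → Γ → Submodule F (specialUnitary F ξ) :=
  fun ν τ => (B.component ν τ).comap (specialUnitary F ξ).toSubmodule.subtype

end BiGrading

end Hermitian

/-- A `(Q × Γ)`-graded and a `(Q' × Γ')`-graded Lie algebra are bi-isomorphic. -/
def BiIsomorphic {F M M' Q Q' Γ Γ' : Type*} [Field F] [LieRing M] [LieAlgebra F M]
    [LieRing M'] [LieAlgebra F M'] [AddCommGroup Q] [AddCommGroup Q'] [AddCommGroup Γ]
    [AddCommGroup Γ'] (ℳ : Q → Γ → Submodule F M) (ℳ' : Q' → Γ' → Submodule F M') : Prop :=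
  ∃ (ψ : M ≃ₗ⁅F⁆ M') (ψr : Q ≃+ Q') (ψe : Γ ≃+ Γ'),
    ∀ μ σ, (ℳ μ σ).map (ψ.toLinearEquiv : M →ₗ[F] M') = ℳ' (ψr μ) (ψe σ)

end UnitaryLie

end

/-!
A vector of `X` is homogeneous of degree `σ` exactly when its coordinates are homogeneous of the
complementary degrees (`mem_iff_coord_mem`), and the operator `U(x, y)` is `F`-bilinear with
`U(x.a, y.b) = U(x.(a b̄), y)`. So the component of degree `(ν, τ)` of the finite unitary algebra is
spanned by the `U(x_p.a, x_q)` with `p`, `q` of total weight `ν` and `a` homogeneous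
(`CompatibleBasis.component_eq_span`), and for `ν ≠ 0` it lies in the special unitary algebra.

From tori to Lie algebras. As `2Γ ⊆ L` and `Γ` has no `2`-torsion, an isomorphism `L ≃ L'` that
matches the doubled supports extends uniquely to `Γ ≃ Γ'` and matches the supports
(`exists_extension`). The support of `X` is a union of cosets of `L`, one for each anisotropic basis
vector: two anisotropic vectors with degrees in the same coset would combine to an isotropic one,
because all scalars are squares (`CompatibleBasis.eq_of_deg_sub_mem`). Hence the anisotropic basis
vectors of `X` and `X'` correspond to each other, and after multiplication by homogeneous units,
adjusted by square roots of scalars, the correspondence of bases extends to a semilinear isometry.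
Conjugation by it is the bi-isomorphism.

From Lie algebras to tori. In degree `0` of `Γ` the special unitary algebra has only roots of square
norm at most `2`, and all `± ε_i ± ε_j` with `i ≠ j` occur. By the parallelogram law the isomorphism
of root lattices therefore permutes the `± ε_i` (`CompatibleBasis.exists_weight_eq_map`). The root
space of `± ε_i ± ε_j` is a copy of `A`, through `a ↦ U(x_i.a, x_j)`, and the bi-isomorphism induces
linear bijections `f_ij : A → A'` on these copies. The brackets of root vectors give
`f_ik(ab) = f_ij̄(a) f_jk(b)`, and `U(x_i.a, x_j) = -U(x_j.ā, x_i)` gives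
`f_ji(ā) = star (f_ij(a))`. Each `f_ij(1)` is a scalar, and with three independent indices at hand
the product rule shows that the `f_ij`, divided by these scalars, agree for enough pairs to be one
isomorphism of algebras with involution (`CompatibleBasis.exists_normalized`). The support of `X`
is recovered as the set of degrees of the root vectors of root `± ε_i`.
-/


noncomputable section

set_option linter.unusedSectionVars false

namespace UnitaryLie

open scoped RightActions Matrix

/-! ### Gradings and homogeneous elements of a torus -/

theorem IsGrading.iSup_eq_top {F X ι : Type*} [Field F] [AddCommGroup X] [Module F X]
    {𝓧 : ι → Submodule F X} (h : IsGrading 𝓧) : ⨆ i, 𝓧 i = ⊤ :=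
  by classical exact DirectSum.IsInternal.submodule_iSup_eq_top h

theorem IsGrading.iSupIndep {F X ι : Type*} [Field F] [AddCommGroup X] [Module F X]
    {𝓧 : ι → Submodule F X} (h : IsGrading 𝓧) : iSupIndep 𝓧 :=
  by classical exact DirectSum.IsInternal.submodule_iSupIndep h

section Torus

variable {F A Γ : Type*} [Field F] [AddCommGroup Γ] {L : AddSubgroup Γ}
  [Ring A] [Algebra F A] [StarRing A] {𝒜 : L → Submodule F A}

theorem extendGrading_coe (𝒜 : L → Submodule F A) (l : L) : extendGrading 𝒜 (l : Γ) = 𝒜 l := by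
  simp [extendGrading]

theorem mem_of_mem_extendGrading {σ : Γ} {a : A} (ha : a ∈ extendGrading 𝒜 σ) (h0 : a ≠ 0) :
    σ ∈ L := by
  by_contra h
  rw [extendGrading, dif_neg h] at ha
  exact h0 ha

namespace IsTorusWithInvolution

variable (h𝒜 : IsTorusWithInvolution 𝒜)

include h𝒜

theorem isUnit {σ : Γ} {a : A} (ha : a ∈ extendGrading 𝒜 σ) (h0 : a ≠ 0) : IsUnit a := by
  have hσ := mem_of_mem_extendGrading ha h0
  lift σ to L using hσ
  rw [extendGrading_coe] at ha
  obtain ⟨u, hu⟩ := h𝒜.spanned_by_unit σ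
  rw [hu, Submodule.mem_span_singleton] at ha
  obtain ⟨c, rfl⟩ := ha
  have hc : c ≠ 0 := by rintro rfl; simp at h0
  exact u.isUnit.smul (Units.mk0 c hc)

theorem exists_unit {σ : Γ} (hσ : σ ∈ L) : ∃ u : Aˣ, (u : A) ∈ extendGrading 𝒜 σ := by
  lift σ to L using hσ
  obtain ⟨u, hu⟩ := h𝒜.spanned_by_unit σ
  exact ⟨u, by rw [extendGrading_coe, hu]; exact Submodule.mem_span_singleton_self _⟩

theorem exists_smul_eq {σ : Γ} {a b : A} (ha : a ∈ extendGrading 𝒜 σ) (h0 : a ≠ 0)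
    (hb : b ∈ extendGrading 𝒜 σ) : ∃ c : F, b = c • a := by
  have hσ := mem_of_mem_extendGrading ha h0
  lift σ to L using hσ
  rw [extendGrading_coe] at ha hb
  obtain ⟨u, hu⟩ := h𝒜.spanned_by_unit σ
  rw [hu, Submodule.mem_span_singleton] at ha hb
  obtain ⟨c, rfl⟩ := ha
  obtain ⟨d, rfl⟩ := hb
  have hc : c ≠ 0 := by rintro rfl; simp at h0
  exact ⟨d / c, by rw [smul_smul, div_mul_cancel₀ _ hc]⟩

theorem mul_mem_extend {σ τ : Γ} {a b : A} (ha : a ∈ extendGrading 𝒜 σ)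
    (hb : b ∈ extendGrading 𝒜 τ) : a * b ∈ extendGrading 𝒜 (σ + τ) := by
  by_cases ha0 : a = 0
  · simp [ha0]
  by_cases hb0 : b = 0
  · simp [hb0]
  have hσ := mem_of_mem_extendGrading ha ha0
  have hτ := mem_of_mem_extendGrading hb hb0
  lift σ to L using hσ
  lift τ to L using hτ
  rw [← AddSubgroup.coe_add]
  rw [extendGrading_coe] at *
  exact h𝒜.mul_mem _ _ _ ha _ hb

theorem star_mem_extend {σ : Γ} {a : A} (ha : a ∈ extendGrading 𝒜 σ) :
    star a ∈ extendGrading 𝒜 σ := by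
  by_cases ha0 : a = 0
  · simp [ha0]
  have hσ := mem_of_mem_extendGrading ha ha0
  lift σ to L using hσ
  rw [extendGrading_coe] at *
  exact h𝒜.star_mem _ _ ha

/-- Multiplicative closure forces the unit into degree `0`: the square of a unit spanning the
component of degree `0` is a multiple of that unit. -/
theorem one_mem : (1 : A) ∈ extendGrading 𝒜 (0 : Γ) := by
  have := h𝒜.nontrivial
  obtain ⟨u, hu⟩ := h𝒜.exists_unit L.zero_mem
  have huu := h𝒜.mul_mem_extend hu hu
  rw [add_zero] at huu
  obtain ⟨c, hc⟩ := h𝒜.exists_smul_eq hu u.ne_zero huu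
  have hc' : (u : A) = c • 1 := by
    have := congrArg (fun x => x * ((u⁻¹ : Aˣ) : A)) hc
    simpa [mul_assoc] using this
  have hc0 : c ≠ 0 := by
    rintro rfl
    exact u.ne_zero (by rw [hc', zero_smul])
  have : (1 : A) = c⁻¹ • (u : A) := by rw [hc', smul_smul, inv_mul_cancel₀ hc0, one_smul]
  rw [this]
  exact Submodule.smul_mem _ _ hu

theorem exists_eq_smul_one {a : A} (ha : a ∈ extendGrading 𝒜 (0 : Γ)) : ∃ c : F, a = c • 1 := by
  have := h𝒜.nontrivial
  exact h𝒜.exists_smul_eq h𝒜.one_mem one_ne_zero ha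

theorem star_smul_one (c : F) : star (c • (1 : A)) = c • 1 := by
  rw [h𝒜.star_smul, star_one]

/-- An additive property of the homogeneous elements holds for all elements. -/
theorem induction_on {p : A → Prop} (a : A)
    (hom : ∀ (l : L), ∀ a ∈ 𝒜 l, p a) (hadd : ∀ a b, p a → p b → p (a + b)) : p a := by
  have ha : a ∈ ⨆ l, 𝒜 l := by
    rw [h𝒜.isGrading.iSup_eq_top]; trivial
  exact Submodule.iSup_induction (motive := p) _ ha hom (hom 0 0 (zero_mem _)) hadd

end IsTorusWithInvolution

end Torus

/-! ### Hermitian forms -/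

section Form

variable {F A X Γ : Type*} [Field F] [AddCommGroup Γ] {L : AddSubgroup Γ}
  [Ring A] [Algebra F A] [StarRing A] [AddCommGroup X] [Module F X] [Module Aᵐᵒᵖ X]
  [IsScalarTower F Aᵐᵒᵖ X] {𝒜 : L → Submodule F A} {𝓧 : Γ → Submodule F X}

theorem smul_one_right (c : F) (x : X) : x <• (c • (1 : A)) = c • x := by
  rw [MulOpposite.op_smul, MulOpposite.op_one, smul_assoc, one_smul]

theorem smul_smul_right (c : F) (a : A) (x : X) : x <• (c • a) = c • (x <• a) := by
  rw [MulOpposite.op_smul, smul_assoc]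

namespace HermitianForm

variable (ξ : HermitianForm A X)

theorem zero_left (y : X) : ξ 0 y = 0 := by
  simpa using ξ.sub_left 0 0 y

theorem zero_right (x : X) : ξ x 0 = 0 := by
  simpa using ξ.sub_right x 0 0

theorem U_add_left (x x' y : X) : ξ.U (x + x') y = ξ.U x y + ξ.U x' y := by
  ext z
  simp only [U_apply, LinearMap.add_apply, ξ.add_left, smul_add, MulOpposite.op_add, add_smul]
  abel

theorem U_swap (x y : X) : ξ.U y x = -ξ.U x y := by
  simp [U]

theorem U_self (x : X) : ξ.U x x = 0 := by
  simp [U]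

theorem U_zero_left (y : X) : ξ.U 0 y = 0 := by
  ext z; simp [U_apply, ξ.zero_left]

theorem U_zero_right (x : X) : ξ.U x 0 = 0 := by
  rw [U_swap, U_zero_left, neg_zero]

theorem U_smul_smul (x y : X) (a b : A) :
    ξ.U (x <• a) (y <• b) = ξ.U (x <• (a * star b)) y := by
  ext z
  simp only [U_apply, ξ.smul_left, MulOpposite.op_mul, mul_smul, star_star]

/-- `U(x.a, y) = -U(y.ā, x)`. -/
theorem U_smul_swap (x y : X) (a : A) : ξ.U (x <• a) y = -ξ.U (y <• star a) x := by
  rw [U_swap]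
  have := ξ.U_smul_smul y x 1 a
  rw [one_mul, MulOpposite.op_one, one_smul] at this
  rw [this]

theorem U_sum_left {ι : Type*} (s : Finset ι) (f : ι → X) (y : X) :
    ξ.U (∑ i ∈ s, f i) y = ∑ i ∈ s, ξ.U (f i) y := by
  classical
  induction s using Finset.induction_on with
  | empty => simp [U_zero_left]
  | insert i s hi ih => rw [Finset.sum_insert hi, Finset.sum_insert hi, U_add_left, ih]

theorem U_sum_right {ι : Type*} (s : Finset ι) (f : ι → X) (x : X) :
    ξ.U x (∑ i ∈ s, f i) = ∑ i ∈ s, ξ.U x (f i) := by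
  rw [U_swap, U_sum_left, ← Finset.sum_neg_distrib]
  exact Finset.sum_congr rfl fun i _ => (ξ.U_swap _ _).symm

variable {ξ}

theorem smul_left_field (h𝒜 : IsTorusWithInvolution 𝒜) (c : F) (x y : X) :
    ξ (c • x) y = c • ξ x y := by
  rw [← smul_one_right (A := A), ξ.smul_left, h𝒜.star_smul_one, smul_mul_assoc, one_mul]

theorem U_smul_left (h𝒜 : IsTorusWithInvolution 𝒜) (c : F) (x y : X) :
    ξ.U (c • x) y = c • ξ.U x y := by
  ext z
  simp only [U_apply, smul_left_field h𝒜, LinearMap.smul_apply, smul_sub]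
  rw [smul_smul_right, smul_comm]

end HermitianForm

/-! ### Coordinates with respect to a homogeneous basis -/

/-- A subfamily of an independent family of subspaces that already spans is the whole family. -/
theorem eq_of_le_of_iSup_eq_top {ι : Type*} {f g : ι → Submodule F X} (hfg : ∀ i, f i ≤ g i)
    (hg : iSupIndep g) (hf : ⨆ i, f i = ⊤) (i : ι) : f i = g i := by
  refine (hfg i).antisymm fun x hx => ?_
  have hx' : x ∈ f i ⊔ ⨆ (j) (_ : j ≠ i), f j := by
    have : f i ⊔ ⨆ (j) (_ : j ≠ i), f j = ⊤ := by
      rw [eq_top_iff, ← hf]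
      refine iSup_le fun j => ?_
      by_cases hj : j = i
      · exact hj ▸ le_sup_left
      · exact (le_iSup₂ (f := fun j (_ : j ≠ i) => f j) j hj).trans le_sup_right
    rw [this]; trivial
  obtain ⟨y, hy, z, hz, rfl⟩ := Submodule.mem_sup.1 hx'
  have hz' : z ∈ ⨆ (j) (_ : j ≠ i), g j := iSup₂_mono (fun j _ => hfg j) hz
  have hz'' : z ∈ g i := by simpa using sub_mem hx (hfg i hy)
  have : z = 0 := by
    have := (hg i).le_bot ⟨hz'', hz'⟩
    simpa using this
  rw [this, add_zero]; exact hy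

variable {ξ : HermitianForm A X} {ι : Type*}

theorem HermitianForm.IsGradedForm.smul_mem_extend (hξ : ξ.IsGradedForm 𝒜 𝓧) {σ τ : Γ} {x : X}
    {a : A} (hx : x ∈ 𝓧 σ) (ha : a ∈ extendGrading 𝒜 τ) : x <• a ∈ 𝓧 (σ + τ) := by
  by_cases ha0 : a = 0
  · simp [ha0]
  have hτ := mem_of_mem_extendGrading ha ha0
  lift τ to L using hτ
  rw [extendGrading_coe] at ha
  exact hξ.smul_mem _ _ _ hx _ ha

/-- The `i`-th coordinate of `x` in a basis of the right module `X`, as an element of `A`. -/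
def coord (b : Module.Basis ι Aᵐᵒᵖ X) (x : X) (i : ι) : A := (b.repr x i).unop

theorem coord_add (b : Module.Basis ι Aᵐᵒᵖ X) (x y : X) (i : ι) :
    coord b (x + y) i = coord b x i + coord b y i := by
  simp [coord]

theorem coord_smul (b : Module.Basis ι Aᵐᵒᵖ X) (a : A) (x : X) (i : ι) :
    coord b (x <• a) i = coord b x i * a := by
  simp [coord]

theorem coord_smul_field (b : Module.Basis ι Aᵐᵒᵖ X) (c : F) (x : X) (i : ι) :
    coord b (c • x) i = c • coord b x i := by
  rw [← smul_one_right (A := A), coord_smul, mul_smul_comm, mul_one]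

theorem coord_self [DecidableEq ι] (b : Module.Basis ι Aᵐᵒᵖ X) (i j : ι) :
    coord b (b i) j = if j = i then 1 else 0 := by
  rw [coord, b.repr_self, Finsupp.single_apply]
  split_ifs <;> simp_all

theorem sum_coord (b : Module.Basis ι Aᵐᵒᵖ X) (x : X) :
    ∑ i ∈ (b.repr x).support, b i <• coord b x i = x :=
  b.linearCombination_repr x

theorem ext_coord (b : Module.Basis ι Aᵐᵒᵖ X) {x y : X} (h : ∀ i, coord b x i = coord b y i) :
    x = y :=
  b.repr.injective (Finsupp.ext fun i => MulOpposite.unop_injective (h i))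

/-- The homogeneous vectors of degree `σ` are the combinations of the basis vectors with homogeneous
coefficients of the complementary degrees: these combinations lie in the components of the grading
and span `X`. -/
theorem mem_iff_coord_mem (h𝒜 : IsTorusWithInvolution 𝒜) (hξ : ξ.IsGradedForm 𝒜 𝓧)
    (b : Module.Basis ι Aᵐᵒᵖ X) {ρ : ι → Γ} (hb : ∀ i, b i ∈ 𝓧 (ρ i)) (σ : Γ) (x : X) :
    x ∈ 𝓧 σ ↔ ∀ i, coord b x i ∈ extendGrading 𝒜 (σ - ρ i) := by
  classical
  let f : Γ → Submodule F X := fun σ =>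
    { carrier := {x | ∀ i, coord b x i ∈ extendGrading 𝒜 (σ - ρ i)}
      zero_mem' := fun i => by simp [coord]
      add_mem' := fun hx hy i => by rw [coord_add]; exact add_mem (hx i) (hy i)
      smul_mem' := fun c x hx i => by
        rw [coord_smul_field]; exact Submodule.smul_mem _ _ (hx i) }
  have hle : ∀ σ, f σ ≤ 𝓧 σ := fun σ x hx => by
    rw [← sum_coord b x]
    refine sum_mem fun i _ => ?_
    have := hξ.smul_mem_extend (hb i) (hx i)
    rwa [add_sub_cancel] at this
  have htop : ⨆ σ, f σ = ⊤ := by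
    rw [eq_top_iff]
    rintro x -
    rw [← sum_coord b x]
    refine sum_mem fun i _ => ?_
    refine h𝒜.induction_on (p := fun a => b i <• a ∈ ⨆ σ, f σ) _ ?_ ?_
    · intro l a ha
      refine Submodule.mem_iSup_of_mem (ρ i + l) fun j => ?_
      rw [coord_smul, coord_self]
      split_ifs with h
      · rw [h, add_sub_cancel_left, extendGrading_coe, one_mul]; exact ha
      · simp
    · intro a a' h h'
      rw [MulOpposite.op_add, add_smul]; exact add_mem h h'
  rw [← eq_of_le_of_iSup_eq_top hle hξ.isGrading.iSupIndep htop σ]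
  rfl

end Form

/-! ### Weights of the basis vectors -/

section Weights

variable {r : ℕ} {K : Type*}

/-- The weight of the basis vector `x_p`: it is `ε_i` for `p = i ≤ r`, `-ε_i` for `p = ī`, and `0`
for `p ∈ K`. -/
def weight : Fin (2 * r) ⊕ K → RootLattice r
  | Sum.inl j => fun i => (if j = Fin.castLE (by omega) i then 1 else 0) -
      (if j = (Fin.castLE (by omega) i : Fin (2 * r)).rev then 1 else 0)
  | Sum.inr _ => 0

theorem rev_ne_self (j : Fin (2 * r)) : j ≠ j.rev := by
  intro h
  have := congrArg Fin.val h
  rw [Fin.val_rev] at this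
  omega

theorem weight_inr (k : K) : weight (r := r) (Sum.inr k) = 0 := rfl

theorem weight_rev (j : Fin (2 * r)) :
    weight (K := K) (Sum.inl j.rev) = -weight (K := K) (Sum.inl j) := by
  ext i
  simp only [weight, Pi.neg_apply, Fin.rev_eq_iff, Fin.rev_rev]
  ring

theorem weight_castLE (i : Fin r) :
    weight (K := K) (Sum.inl (Fin.castLE (by omega) i)) = Pi.single i 1 := by
  ext l
  simp only [weight, Pi.single_apply, Fin.ext_iff, Fin.val_rev, Fin.val_castLE]
  have := i.2
  have := l.2
  split_ifs <;> omega

theorem exists_castLE (j : Fin (2 * r)) :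
    ∃ i : Fin r, j = Fin.castLE (by omega) i ∨ j = (Fin.castLE (by omega) i : Fin (2 * r)).rev := by
  rcases lt_or_ge j.1 r with h | h
  · exact ⟨⟨j, h⟩, Or.inl rfl⟩
  · refine ⟨⟨2 * r - 1 - j, by omega⟩, Or.inr ?_⟩
    ext
    simp only [Fin.val_rev, Fin.val_castLE]
    omega

open scoped Classical in
theorem weight_dotProduct (p : Fin (2 * r) ⊕ K) (j : Fin (2 * r)) :
    weight p ⬝ᵥ weight (K := K) (Sum.inl j) =
      (if p = Sum.inl j then 1 else 0) - (if p = Sum.inl j.rev then 1 else 0) := by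
  obtain ⟨i, rfl | rfl⟩ := exists_castLE j
  · rw [weight_castLE, dotProduct_single, mul_one]
    cases p <;> simp [weight]
  · rw [weight_rev, weight_castLE, dotProduct_neg, dotProduct_single, mul_one, Fin.rev_rev]
    cases p <;> simp [weight]

theorem weight_inl_dotProduct_self (j : Fin (2 * r)) :
    weight (K := K) (Sum.inl j) ⬝ᵥ weight (K := K) (Sum.inl j) = 1 := by
  rw [weight_dotProduct, if_pos rfl, if_neg (by simpa using rev_ne_self j), sub_zero]

theorem weight_dotProduct_self_le (p : Fin (2 * r) ⊕ K) : weight p ⬝ᵥ weight p ≤ 1 := by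
  cases p with
  | inl j => exact (weight_inl_dotProduct_self j).le
  | inr k => simp [weight_inr]

theorem eq_inl_of_weight_eq {p : Fin (2 * r) ⊕ K} {j : Fin (2 * r)}
    (h : weight p = weight (K := K) (Sum.inl j)) : p = Sum.inl j := by
  have h1 := weight_dotProduct p j
  rw [h, weight_inl_dotProduct_self] at h1
  by_contra hp
  rw [if_neg hp] at h1
  split_ifs at h1 <;> omega

theorem weight_inl_ne_zero (j : Fin (2 * r)) : weight (K := K) (Sum.inl j) ≠ 0 := by
  intro h
  have := weight_inl_dotProduct_self (K := K) j
  rw [h] at this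
  simp at this

theorem exists_weight_eq {v : RootLattice r} (hv : v ⬝ᵥ v = 1) :
    ∃ j, weight (K := K) (Sum.inl j) = v := by
  have h0 : ∃ i, v i ≠ 0 := by
    by_contra! h
    have : v = 0 := funext h
    simp [this] at hv
  obtain ⟨i, hi⟩ := h0
  have hsum : v i * v i + ∑ l ∈ Finset.univ.erase i, v l * v l = 1 := by
    rw [Finset.add_sum_erase _ (fun l => v l * v l) (Finset.mem_univ i)]; exact hv
  have hpos : 0 < v i * v i := mul_self_pos.2 hi
  have hnn : 0 ≤ ∑ l ∈ Finset.univ.erase i, v l * v l :=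
    Finset.sum_nonneg fun l _ => mul_self_nonneg _
  have hz : ∑ l ∈ Finset.univ.erase i, v l * v l = 0 := by omega
  have hother : ∀ l, l ≠ i → v l = 0 := by
    intro l hl
    have := (Finset.sum_eq_zero_iff_of_nonneg fun l _ => mul_self_nonneg (v l)).1 hz l
      (Finset.mem_erase.2 ⟨hl, Finset.mem_univ _⟩)
    exact mul_self_eq_zero.1 this
  have h1 : v i * v i = 1 := by omega
  have hv' : v = Pi.single i (v i) := by
    ext l
    by_cases hl : l = i
    · subst hl; simp
    · rw [Pi.single_eq_of_ne hl, hother l hl]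
  rcases mul_self_eq_one_iff.1 h1 with h | h
  · refine ⟨Fin.castLE (by omega) i, ?_⟩
    rw [weight_castLE, hv', h]
  · refine ⟨(Fin.castLE (by omega) i : Fin (2 * r)).rev, ?_⟩
    rw [weight_rev, weight_castLE, hv', h, Pi.single_neg]

/-- A sum of two weights has square norm at most `2`, except for the weights `± 2 ε_i`. -/
theorem weight_add_norm_le {p q : Fin (2 * r) ⊕ K} (h : ∀ j, ¬ (p = Sum.inl j ∧ q = Sum.inl j)) :
    (weight p + weight q) ⬝ᵥ (weight p + weight q) ≤ 2 := by
  have hp := weight_dotProduct_self_le p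
  have hq := weight_dotProduct_self_le q
  have hpq : weight p ⬝ᵥ weight q ≤ 0 := by
    cases q with
    | inr k => simp [weight_inr]
    | inl j =>
      rw [weight_dotProduct, if_neg fun hj => h j ⟨hj, rfl⟩]
      split_ifs <;> omega
  rw [add_dotProduct, dotProduct_add, dotProduct_add, dotProduct_comm (weight q) (weight p)]
  omega

theorem eq_or_eq_of_dotProduct_add {p q : Fin (2 * r) ⊕ K} {i : Fin (2 * r)}
    (h : (weight p + weight q) ⬝ᵥ weight (K := K) (Sum.inl i) = 1) :
    p = Sum.inl i ∨ q = Sum.inl i := by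
  by_contra! hne
  rw [add_dotProduct, weight_dotProduct, weight_dotProduct, if_neg hne.1, if_neg hne.2] at h
  split_ifs at h <;> omega

theorem eq_of_weight_add_eq {p q : Fin (2 * r) ⊕ K} {i j : Fin (2 * r)} (hij : i ≠ j)
    (hij' : i ≠ j.rev)
    (h : weight p + weight q = weight (K := K) (Sum.inl i) + weight (K := K) (Sum.inl j)) :
    (p = Sum.inl i ∧ q = Sum.inl j) ∨ (p = Sum.inl j ∧ q = Sum.inl i) := by
  have hji' : j ≠ i.rev := fun h => hij' (by rw [h, Fin.rev_rev])
  have hi : p = Sum.inl i ∨ q = Sum.inl i := eq_or_eq_of_dotProduct_add <| by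
    rw [h, add_dotProduct, weight_inl_dotProduct_self, weight_dotProduct]
    simp [hij.symm, hji']
  rcases hi with rfl | rfl
  · exact Or.inl ⟨rfl, eq_inl_of_weight_eq (add_left_cancel h)⟩
  · rw [add_comm] at h
    exact Or.inr ⟨eq_inl_of_weight_eq (add_left_cancel h), rfl⟩

theorem eq_of_weight_add_eq_weight {p q : Fin (2 * r) ⊕ K} {i : Fin (2 * r)}
    (h : weight p + weight q = weight (K := K) (Sum.inl i)) :
    (p = Sum.inl i ∧ ∃ k, q = Sum.inr k) ∨ (q = Sum.inl i ∧ ∃ k, p = Sum.inr k) := by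
  have key : ∀ {p q : Fin (2 * r) ⊕ K}, weight p + weight q = weight (K := K) (Sum.inl i) →
      p = Sum.inl i → ∃ k, q = Sum.inr k := by
    rintro p q h rfl
    have hq : weight q = 0 := by simpa using h
    cases q with
    | inl j => exact absurd hq (weight_inl_ne_zero j)
    | inr k => exact ⟨k, rfl⟩
  have hi : p = Sum.inl i ∨ q = Sum.inl i := eq_or_eq_of_dotProduct_add <| by
    rw [h, weight_inl_dotProduct_self]
  rcases hi with hp | hq
  · exact Or.inl ⟨hp, key h hp⟩
  · exact Or.inr ⟨hq, key (by rw [add_comm, h]) hq⟩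

theorem weight_add_ne_zero {i j : Fin (2 * r)} (hij' : i ≠ j.rev) :
    weight (K := K) (Sum.inl i) + weight (K := K) (Sum.inl j) ≠ 0 := by
  intro h
  rw [add_eq_zero_iff_eq_neg, ← weight_rev] at h
  exact hij' (Sum.inl_injective (eq_inl_of_weight_eq h))

end Weights

/-! ### Components of the unitary Lie algebras -/

namespace CompatibleBasis

variable {F A X Γ K : Type*} [Field F] [AddCommGroup Γ] {L : AddSubgroup Γ}
  [Ring A] [Algebra F A] [StarRing A] [AddCommGroup X] [Module F X] [Module Aᵐᵒᵖ X]
  [IsScalarTower F Aᵐᵒᵖ X] {r : ℕ} {𝒜 : L → Submodule F A} {𝓧 : Γ → Submodule F X}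
  {ξ : HermitianForm A X} (B : CompatibleBasis r 𝒜 𝓧 ξ K)

/-- The degree of the basis vector `x_p`, with the value `0` for `p ∈ J`. -/
def deg : Fin (2 * r) ⊕ K → Γ :=
  Sum.elim (fun _ => 0) fun k => (B.homogeneous (Sum.inr k)).choose

theorem basis_mem (p : Fin (2 * r) ⊕ K) : B.basis p ∈ 𝓧 (B.deg p) := by
  cases p with
  | inl j => exact B.deg_hyp j
  | inr k => exact (B.homogeneous (Sum.inr k)).choose_spec

@[simp] theorem deg_inl (j : Fin (2 * r)) : B.deg (Sum.inl j) = 0 := rfl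

theorem form_inl_inl (i j : Fin (2 * r)) :
    ξ (B.basis (Sum.inl i)) (B.basis (Sum.inl j)) = if i = j.rev then 1 else 0 := by
  rw [B.form_eq, B.γ_hyp]
  simp [bar]

@[simp] theorem form_inl_inr (i : Fin (2 * r)) (k : K) :
    ξ (B.basis (Sum.inl i)) (B.basis (Sum.inr k)) = 0 := by
  rw [B.form_eq]; simp [bar]

@[simp] theorem form_inr_inl (i : Fin (2 * r)) (k : K) :
    ξ (B.basis (Sum.inr k)) (B.basis (Sum.inl i)) = 0 := by
  rw [B.form_eq]; simp [bar]

theorem form_inr_self (k : K) :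
    ξ (B.basis (Sum.inr k)) (B.basis (Sum.inr k)) = B.γ (Sum.inr k) := by
  rw [B.form_eq]; simp [bar]

theorem form_inr_of_ne {k l : K} (h : k ≠ l) :
    ξ (B.basis (Sum.inr k)) (B.basis (Sum.inr l)) = 0 := by
  rw [B.form_eq]; simp [bar, h]

theorem h_basis (i : Fin r) (p : Fin (2 * r) ⊕ K) :
    B.h i (B.basis p) = weight p i • B.basis p := by
  have hb : bar (K := K) (Sum.inl (Fin.castLE (by omega) i)) =
      Sum.inl (Fin.castLE (by omega) i : Fin (2 * r)).rev := rfl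
  simp only [h, HermitianForm.U_apply, hb]
  cases p with
  | inr k => simp [weight]
  | inl j =>
    simp only [form_inl_inl, weight, Fin.rev_inj, sub_smul]
    congr 1
    · by_cases h : j = Fin.castLE (by omega) i
      · simp [h]
      · rw [if_neg h, if_neg (Ne.symm h)]; simp
    · by_cases h : j = (Fin.castLE (by omega) i : Fin (2 * r)).rev
      · simp [h]
      · rw [if_neg h, if_neg fun h' => h (by rw [h', Fin.rev_rev])]; simp

theorem coord_h (i : Fin r) (x : X) (p : Fin (2 * r) ⊕ K) :
    coord B.basis (B.h i x) p = weight p i • coord B.basis x p := by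
  classical
  conv_lhs => rw [← sum_coord B.basis x]
  rw [map_sum]
  simp only [map_smul, h_basis]
  rw [coord, map_sum, Finsupp.finsetSum_apply]
  rw [Finset.sum_congr rfl (g := fun q => if q = p then
    (weight p i : ℤ) • MulOpposite.op (coord B.basis x p) else 0)]
  · rw [Finset.sum_ite_eq']
    split_ifs with hp
    · simpa using (Int.cast_commute (weight p i) (coord B.basis x p)).symm.eq
    · rw [Finsupp.notMem_support_iff] at hp
      simp [coord, hp]
  · intro q _
    rw [map_smul, map_zsmul, B.basis.repr_self, Finsupp.smul_apply, Finsupp.smul_apply,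
      Finsupp.single_apply]
    split_ifs with hq
    · subst hq; rw [smul_comm, smul_eq_mul, mul_one]
    · simp

variable [CharZero F]

theorem mem_weightSpace_iff (x : X) (lam : RootLattice r) :
    x ∈ B.weightSpace lam ↔ ∀ p, coord B.basis x p ≠ 0 → weight p = lam := by
  change (∀ i, B.h i x = lam i • x) ↔ _
  constructor
  · intro hx p hp
    ext i
    have h1 := congrArg (fun y => coord B.basis y p) (hx i)
    simp only [coord_h] at h1
    have h2 : coord B.basis (lam i • x) p = lam i • coord B.basis x p := by
      rw [← Int.cast_smul_eq_zsmul F (lam i) x, coord_smul_field, Int.cast_smul_eq_zsmul]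
    rw [h2, ← sub_eq_zero, ← sub_smul, ← Int.cast_smul_eq_zsmul F, smul_eq_zero, Int.cast_eq_zero,
      sub_eq_zero] at h1
    exact h1.resolve_right hp
  · intro hx i
    refine ext_coord B.basis fun p => ?_
    rw [coord_h, ← Int.cast_smul_eq_zsmul F (lam i) x, coord_smul_field, Int.cast_smul_eq_zsmul]
    by_cases hp : coord B.basis x p = 0
    · simp [hp]
    · rw [hx p hp]

theorem basis_smul_mem_weightSpace (p : Fin (2 * r) ⊕ K) (a : A) :
    B.basis p <• a ∈ B.weightSpace (weight p) := by
  classical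
  rw [mem_weightSpace_iff]
  intro q hq
  rw [coord_smul, coord_self] at hq
  split_ifs at hq with h
  · rw [h]
  · simp at hq

/-- The component of degree `(ν, τ)` is spanned by the operators `U(x_p.a, x_q)` with `a`
homogeneous, as `U(x.a, y.b) = U(x.(a b̄), y)`. -/
theorem component_eq_span (h𝒜 : IsTorusWithInvolution 𝒜) (hξ : ξ.IsGradedForm 𝒜 𝓧)
    (ν : RootLattice r) (τ : Γ) :
    B.component ν τ = Submodule.span F {T | ∃ p q a, weight p + weight q = ν ∧
      a ∈ extendGrading 𝒜 (τ - B.deg p - B.deg q) ∧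
      T = ξ.U (B.basis p <• a) (B.basis q)} := by
  apply le_antisymm
  · rw [component, Submodule.span_le]
    rintro _ ⟨lam, μ, ρ, σ, x, y, rfl, rfl, ⟨hx, hx'⟩, ⟨hy, hy'⟩, rfl⟩
    rw [SetLike.mem_coe]
    rw [SetLike.mem_coe, mem_weightSpace_iff] at hx hy
    rw [SetLike.mem_coe, mem_iff_coord_mem h𝒜 hξ B.basis B.basis_mem] at hx' hy'
    rw [← sum_coord B.basis x, ← sum_coord B.basis y, ξ.U_sum_left]
    refine sum_mem fun p _ => ?_
    rw [ξ.U_sum_right]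
    refine sum_mem fun q _ => ?_
    rw [ξ.U_smul_smul]
    by_cases hp0 : coord B.basis x p = 0
    · rw [hp0, zero_mul, MulOpposite.op_zero, zero_smul, ξ.U_zero_left]; exact zero_mem _
    by_cases hq0 : coord B.basis y q = 0
    · rw [hq0, star_zero, mul_zero, MulOpposite.op_zero, zero_smul, ξ.U_zero_left]
      exact zero_mem _
    refine Submodule.subset_span ⟨p, q, _, by rw [hx p hp0, hy q hq0], ?_, rfl⟩
    have := h𝒜.mul_mem_extend (hx' p) (h𝒜.star_mem_extend (hy' q))
    convert this using 2
    abel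
  · rw [Submodule.span_le]
    rintro _ ⟨p, q, a, rfl, ha, rfl⟩
    refine Submodule.subset_span ⟨weight p, weight q, τ - B.deg q, B.deg q, _, _, rfl, by abel,
      ⟨B.basis_smul_mem_weightSpace p a, ?_⟩, ⟨?_, B.basis_mem q⟩, rfl⟩
    · have := hξ.smul_mem_extend (B.basis_mem p) ha
      rw [SetLike.mem_coe]
      convert this using 2
      abel
    · simpa using B.basis_smul_mem_weightSpace q 1

theorem h_apply_smul (i : Fin r) (p : Fin (2 * r) ⊕ K) (a : A) :
    B.h i (B.basis p <• a) = (weight p i : F) • (B.basis p <• a) := by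
  rw [map_smul, h_basis, Int.cast_smul_eq_zsmul, smul_comm]

theorem h_mem (i : Fin r) : B.h i ∈ finiteUnitary F ξ :=
  Submodule.subset_span ⟨_, _, rfl⟩

theorem U_mem (x y : X) : ξ.U x y ∈ finiteUnitary F ξ :=
  Submodule.subset_span ⟨_, _, rfl⟩

/-- Every root vector of nonzero root is a multiple of its bracket with some `h_i`, hence lies in
the derived algebra. -/
theorem U_basis_mem_specialUnitary (h𝒜 : IsTorusWithInvolution 𝒜) {p q : Fin (2 * r) ⊕ K}
    (hpq : weight p + weight q ≠ 0) (a : A) :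
    ξ.U (B.basis p <• a) (B.basis q) ∈ specialUnitary F ξ := by
  obtain ⟨i, hi⟩ : ∃ i, (weight p + weight q) i ≠ 0 := by
    by_contra! h
    exact hpq (funext h)
  have hbr : ⁅B.h i, ξ.U (B.basis p <• a) (B.basis q)⁆ =
      ((((weight p + weight q) i : ℤ) : F)) • ξ.U (B.basis p <• a) (B.basis q) := by
    have hb : ∀ x y, ⁅B.h i, ξ.U x y⁆ = ξ.U (B.h i x) y + ξ.U x (B.h i y) :=
      fun x y => ξ.bracket_U _ _ _ _
    have hq : B.h i (B.basis q) = (weight q i : F) • B.basis q := by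
      simpa using B.h_apply_smul i q 1
    rw [hb, h_apply_smul (F := F), hq, ξ.U_swap _ (B.basis p <• a), HermitianForm.U_smul_left h𝒜,
      HermitianForm.U_smul_left h𝒜, ξ.U_swap (B.basis p <• a), Pi.add_apply, Int.cast_add, add_smul,
      smul_neg, neg_neg]
  have hc : (((weight p + weight q) i : ℤ) : F) ≠ 0 := Int.cast_ne_zero.2 hi
  have : ξ.U (B.basis p <• a) (B.basis q) =
      (((weight p + weight q) i : ℤ) : F)⁻¹ • ⁅B.h i, ξ.U (B.basis p <• a) (B.basis q)⁆ := by
    rw [hbr, smul_smul, inv_mul_cancel₀ hc, one_smul]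
  rw [this]
  exact (specialUnitary F ξ).smul_mem _
    (Submodule.subset_span ⟨_, B.h_mem i, _, U_mem _ _, rfl⟩)

theorem component_le_specialUnitary (h𝒜 : IsTorusWithInvolution 𝒜) (hξ : ξ.IsGradedForm 𝒜 𝓧)
    {ν : RootLattice r} (hν : ν ≠ 0) (τ : Γ) :
    B.component ν τ ≤ (specialUnitary F ξ).toSubmodule := by
  rw [component_eq_span B h𝒜 hξ, Submodule.span_le]
  rintro _ ⟨p, q, a, rfl, -, rfl⟩
  exact B.U_basis_mem_specialUnitary h𝒜 hν a

/-- In degree `0` of `Γ`, a root has square norm at most `2`: the operators of root `± 2 ε_i` are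
the `U(x_j.a, x_j)` with `a` skew, and degree `0` contains only scalars, which are symmetric. -/
theorem norm_le_two_of_component_ne_bot (h𝒜 : IsTorusWithInvolution 𝒜)
    (hξ : ξ.IsGradedForm 𝒜 𝓧) {ν : RootLattice r} (hν : B.component ν (0 : Γ) ≠ ⊥) :
    ν ⬝ᵥ ν ≤ 2 := by
  rw [component_eq_span B h𝒜 hξ, Ne, Submodule.span_eq_bot] at hν
  push Not at hν
  obtain ⟨_, ⟨p, q, a, rfl, ha, rfl⟩, hT⟩ := hν
  refine weight_add_norm_le ?_
  rintro j ⟨rfl, rfl⟩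
  simp only [deg_inl, sub_zero] at ha
  obtain ⟨c, rfl⟩ := h𝒜.exists_eq_smul_one ha
  rw [smul_one_right, HermitianForm.U_smul_left h𝒜, ξ.U_self, smul_zero] at hT
  exact hT rfl

/-! ### The root vectors of roots `± ε_i ± ε_j` -/

/-- The operator `U(x_i.a, x_j)`, `i, j ∈ J`, as a linear function of `a ∈ A`. -/
def rootMap (h𝒜 : IsTorusWithInvolution 𝒜) (i j : Fin (2 * r)) : A →ₗ[F] Module.End Aᵐᵒᵖ X where
  toFun a := ξ.U (B.basis (Sum.inl i) <• a) (B.basis (Sum.inl j))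
  map_add' a b := by rw [MulOpposite.op_add, add_smul, ξ.U_add_left]
  map_smul' c a := by rw [smul_smul_right, HermitianForm.U_smul_left h𝒜]; rfl

theorem rootMap_apply (h𝒜 : IsTorusWithInvolution 𝒜) (i j : Fin (2 * r)) (a : A) :
    B.rootMap h𝒜 i j a = ξ.U (B.basis (Sum.inl i) <• a) (B.basis (Sum.inl j)) := rfl

theorem rootMap_swap (h𝒜 : IsTorusWithInvolution 𝒜) (i j : Fin (2 * r)) (a : A) :
    B.rootMap h𝒜 j i (star a) = -B.rootMap h𝒜 i j a := by
  rw [rootMap_apply, rootMap_apply, ξ.U_smul_swap, star_star]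

theorem rootMap_apply_basis (h𝒜 : IsTorusWithInvolution 𝒜) {i j : Fin (2 * r)} (hij : i ≠ j)
    (a : A) : B.rootMap h𝒜 i j a (B.basis (Sum.inl j.rev)) = B.basis (Sum.inl i) <• a := by
  rw [rootMap_apply, HermitianForm.U_apply, ξ.smul_left, form_inl_inl, form_inl_inl, Fin.rev_rev,
    if_pos rfl, if_neg hij]
  simp

theorem rootMap_injective (h𝒜 : IsTorusWithInvolution 𝒜) {i j : Fin (2 * r)} (hij : i ≠ j) :
    Function.Injective (B.rootMap h𝒜 i j) := by
  intro a b hab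
  have h1 := congrArg (fun T => coord B.basis (T (B.basis (Sum.inl j.rev))) (Sum.inl i)) hab
  classical
  simpa [rootMap_apply_basis B h𝒜 hij, coord_smul, coord_self] using h1

/-- `[U(x_i.a, x_j̄), U(x_j.b, x_k)] = U(x_i.ab, x_k)` for indices that pair trivially. -/
theorem bracket_rootMap (h𝒜 : IsTorusWithInvolution 𝒜) {i j k : Fin (2 * r)}
    (hij : i ≠ j.rev) (hkj : k ≠ j) (hik : i ≠ k.rev) (a b : A) :
    ⁅B.rootMap h𝒜 i j.rev a, B.rootMap h𝒜 j k b⁆ = B.rootMap h𝒜 i k (a * b) := by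
  have hjk : j ≠ k := hkj.symm
  have h1 : B.rootMap h𝒜 i j.rev a (B.basis (Sum.inl j) <• b) =
      B.basis (Sum.inl i) <• (a * b) := by
    have := B.rootMap_apply_basis h𝒜 hij a
    rw [Fin.rev_rev] at this
    rw [map_smul, this, MulOpposite.op_mul, mul_smul]
  have h2 : B.rootMap h𝒜 i j.rev a (B.basis (Sum.inl k)) = 0 := by
    rw [rootMap_apply, HermitianForm.U_apply, ξ.smul_left, form_inl_inl, form_inl_inl,
      if_neg hik, if_neg (by rwa [Fin.rev_inj])]
    simp
  rw [rootMap_apply B h𝒜 j k, rootMap_apply B h𝒜 i j.rev, ξ.bracket_U,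
    ← rootMap_apply B h𝒜 i j.rev, h1, h2, ξ.U_zero_right, add_zero, rootMap_apply]

theorem component_weight_add (h𝒜 : IsTorusWithInvolution 𝒜) (hξ : ξ.IsGradedForm 𝒜 𝓧)
    {i j : Fin (2 * r)} (hij : i ≠ j) (hij' : i ≠ j.rev) (τ : Γ) :
    B.component (weight (K := K) (Sum.inl i) + weight (K := K) (Sum.inl j)) τ =
      (extendGrading 𝒜 τ).map (B.rootMap h𝒜 i j) := by
  rw [component_eq_span B h𝒜 hξ]
  apply le_antisymm
  · rw [Submodule.span_le]
    rintro _ ⟨p, q, a, hpq, ha, rfl⟩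
    rcases eq_of_weight_add_eq hij hij' hpq with ⟨rfl, rfl⟩ | ⟨rfl, rfl⟩
    · exact ⟨a, by simpa using ha, rfl⟩
    · refine ⟨-star a, ?_, ?_⟩
      · simpa using h𝒜.star_mem_extend ha
      · rw [map_neg, rootMap_swap, neg_neg, rootMap_apply]
  · rintro _ ⟨a, ha, rfl⟩
    exact Submodule.subset_span ⟨_, _, a, rfl, by simpa using ha, rfl⟩

theorem rootMap_mem_component_iff (h𝒜 : IsTorusWithInvolution 𝒜) (hξ : ξ.IsGradedForm 𝒜 𝓧)
    {i j : Fin (2 * r)} (hij : i ≠ j) (hij' : i ≠ j.rev) (τ : Γ) (a : A) :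
    B.rootMap h𝒜 i j a ∈
      B.component (weight (K := K) (Sum.inl i) + weight (K := K) (Sum.inl j)) τ ↔
      a ∈ extendGrading 𝒜 τ := by
  rw [component_weight_add B h𝒜 hξ hij hij']
  constructor
  · rintro ⟨b, hb, hab⟩
    rwa [← B.rootMap_injective h𝒜 hij hab]
  · exact fun ha => ⟨a, ha, rfl⟩

theorem component_ne_bot_iff (h𝒜 : IsTorusWithInvolution 𝒜) (hξ : ξ.IsGradedForm 𝒜 𝓧)
    {i j : Fin (2 * r)} (hij : i ≠ j) (hij' : i ≠ j.rev) (τ : Γ) :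
    B.component (weight (K := K) (Sum.inl i) + weight (K := K) (Sum.inl j)) τ ≠ ⊥ ↔ τ ∈ L := by
  rw [component_weight_add B h𝒜 hξ hij hij', Submodule.ne_bot_iff]
  have := h𝒜.nontrivial
  constructor
  · rintro ⟨_, ⟨a, ha, rfl⟩, h0⟩
    refine mem_of_mem_extendGrading ha ?_
    rintro rfl
    exact h0 (map_zero _)
  · intro hτ
    obtain ⟨u, hu⟩ := h𝒜.exists_unit hτ
    exact ⟨_, ⟨u, hu, rfl⟩, (map_ne_zero_iff _ (B.rootMap_injective h𝒜 hij)).2 u.ne_zero⟩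

/-! ### The support of `X` -/

theorem deg_k₀_mem (h𝒜 : IsTorusWithInvolution 𝒜) (hξ : ξ.IsGradedForm 𝒜 𝓧) :
    B.deg (Sum.inr B.k₀) ∈ L := by
  classical
  have := h𝒜.nontrivial
  have h := (mem_iff_coord_mem h𝒜 hξ B.basis B.basis_mem 0 _).1 B.deg_k₀ (Sum.inr B.k₀)
  rw [coord_self, if_pos rfl] at h
  simpa using mem_of_mem_extendGrading h one_ne_zero

/-- The support of `X` is the union of the cosets of `L` of the degrees of the anisotropic basis
vectors; that of `x_{k₀}` is `L` itself, which accounts for the hyperbolic part. -/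
theorem mem_supp_iff (h𝒜 : IsTorusWithInvolution 𝒜) (hξ : ξ.IsGradedForm 𝒜 𝓧) (τ : Γ) :
    τ ∈ supp 𝓧 ↔ ∃ k, τ - B.deg (Sum.inr k) ∈ L := by
  classical
  have := h𝒜.nontrivial
  change 𝓧 τ ≠ ⊥ ↔ _
  rw [Submodule.ne_bot_iff]
  constructor
  · rintro ⟨x, hx, h0⟩
    rw [mem_iff_coord_mem h𝒜 hξ B.basis B.basis_mem] at hx
    obtain ⟨p, hp⟩ : ∃ p, coord B.basis x p ≠ 0 := by
      by_contra! h
      exact h0 (ext_coord B.basis fun i => by rw [h i]; simp [coord])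
    have hL := mem_of_mem_extendGrading (hx p) hp
    cases p with
    | inr k => exact ⟨k, hL⟩
    | inl j => exact ⟨B.k₀, L.sub_mem (by simpa using hL) (B.deg_k₀_mem h𝒜 hξ)⟩
  · rintro ⟨k, hk⟩
    obtain ⟨u, hu⟩ := h𝒜.exists_unit hk
    refine ⟨B.basis (Sum.inr k) <• (u : A), ?_, ?_⟩
    · have := hξ.smul_mem_extend (B.basis_mem (Sum.inr k)) hu
      rwa [add_sub_cancel] at this
    · intro h
      have := congrArg (fun x => coord B.basis x (Sum.inr k)) h
      simp only [coord_smul, coord_self, if_pos, one_mul] at this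
      simp [coord] at this

/-- The support of `X` is the set of degrees of the root vectors of any one root `± ε_i`. -/
theorem component_weight_ne_bot_iff (h𝒜 : IsTorusWithInvolution 𝒜) (hξ : ξ.IsGradedForm 𝒜 𝓧)
    (i : Fin (2 * r)) (τ : Γ) :
    B.component (weight (K := K) (Sum.inl i)) τ ≠ ⊥ ↔ τ ∈ supp 𝓧 := by
  classical
  have := h𝒜.nontrivial
  rw [mem_supp_iff B h𝒜 hξ]
  constructor
  · intro h
    rw [component_eq_span B h𝒜 hξ, Ne, Submodule.span_eq_bot] at h
    push Not at h
    obtain ⟨_, ⟨p, q, a, hpq, ha, rfl⟩, hT⟩ := h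
    have ha0 : a ≠ 0 := by
      rintro rfl
      rw [MulOpposite.op_zero, zero_smul, ξ.U_zero_left] at hT
      exact hT rfl
    have hL := mem_of_mem_extendGrading ha ha0
    rcases eq_of_weight_add_eq_weight hpq with ⟨rfl, k, rfl⟩ | ⟨rfl, k, rfl⟩
    · exact ⟨k, by simpa using hL⟩
    · exact ⟨k, by simpa using hL⟩
  · rintro ⟨k, hk⟩
    obtain ⟨u, hu⟩ := h𝒜.exists_unit hk
    rw [component_eq_span B h𝒜 hξ, Submodule.ne_bot_iff]
    refine ⟨_, Submodule.subset_span ⟨Sum.inr k, Sum.inl i, u, by simp [weight_inr],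
      by simpa using hu, rfl⟩, ?_⟩
    intro h
    have h1 := congrArg
      (fun T => coord B.basis (T (B.basis (Sum.inl i.rev))) (Sum.inr k)) h
    simp [HermitianForm.U_apply, ξ.smul_left, form_inl_inl, coord_smul, coord_self] at h1
    simp [coord] at h1

theorem twice_deg_mem (hξ : ξ.IsGradedForm 𝒜 𝓧) (k : K) : 2 • B.deg (Sum.inr k) ∈ L := by
  have h := hξ.form_mem _ _ _ (B.basis_mem (Sum.inr k)) _ (B.basis_mem (Sum.inr k))
  rw [form_inr_self, ← two_nsmul] at h
  exact mem_of_mem_extendGrading h (B.γ_ne_zero _)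

theorem twice_mem_of_mem_supp (B : CompatibleBasis r 𝒜 𝓧 ξ K)
    (h𝒜 : IsTorusWithInvolution 𝒜) (hξ : ξ.IsGradedForm 𝒜 𝓧) {σ : Γ}
    (hσ : σ ∈ supp 𝓧) : 2 • σ ∈ L := by
  obtain ⟨k, hk⟩ := (B.mem_supp_iff h𝒜 hξ σ).1 hσ
  have := L.add_mem (L.nsmul_mem hk 2) (B.twice_deg_mem hξ k)
  rwa [← smul_add, sub_add_cancel] at this

end CompatibleBasis

/-! ### Recovering the torus from the Lie algebra -/

theorem castLE_ne {r : ℕ} {a b : Fin r} (h : a ≠ b) :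
    (Fin.castLE (by omega) a : Fin (2 * r)) ≠ Fin.castLE (by omega) b := by
  simpa using h

theorem castLE_ne_rev {r : ℕ} (a b : Fin r) :
    (Fin.castLE (by omega) a : Fin (2 * r)) ≠ (Fin.castLE (by omega) b : Fin (2 * r)).rev := by
  intro h
  have := congrArg Fin.val h
  simp only [Fin.val_rev, Fin.val_castLE] at this
  omega

theorem exists_orthogonal {r : ℕ} (hr : 2 ≤ r) (i : Fin (2 * r)) :
    ∃ j : Fin (2 * r), i ≠ j ∧ i ≠ j.rev := by
  have : Nontrivial (Fin r) := Fin.nontrivial_iff_two_le.2 hr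
  obtain ⟨a, ha⟩ := exists_castLE i
  obtain ⟨b, hb⟩ := exists_ne a
  refine ⟨Fin.castLE (by omega) b, ?_⟩
  rcases ha with rfl | rfl
  · exact ⟨castLE_ne hb.symm, castLE_ne_rev _ _⟩
  · exact ⟨(castLE_ne_rev _ _).symm, fun h => castLE_ne hb.symm (Fin.rev_injective h)⟩

namespace CompatibleBasis

variable {F : Type*} [Field F] [CharZero F] {r : ℕ}

section Single

variable {A X Γ K : Type*} [AddCommGroup Γ] {L : AddSubgroup Γ}
  [Ring A] [Algebra F A] [StarRing A] [AddCommGroup X] [Module F X] [Module Aᵐᵒᵖ X]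
  [IsScalarTower F Aᵐᵒᵖ X] {𝒜 : L → Submodule F A} {𝓧 : Γ → Submodule F X}
  {ξ : HermitianForm A X} (B : CompatibleBasis r 𝒜 𝓧 ξ K)

/-- The operator `U(x_i.a, x_j)`, `i ≠ j̄`, as an element of the special unitary Lie algebra
depending linearly on `a`. -/
def rootVector (h𝒜 : IsTorusWithInvolution 𝒜) (i j : Fin (2 * r)) (h : i ≠ j.rev) :
    A →ₗ[F] specialUnitary F ξ :=
  LinearMap.codRestrict (specialUnitary F ξ).toSubmodule (B.rootMap h𝒜 i j) fun a =>
    B.U_basis_mem_specialUnitary h𝒜 (weight_add_ne_zero h) a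

@[simp] theorem coe_rootVector (h𝒜 : IsTorusWithInvolution 𝒜) {i j : Fin (2 * r)}
    (h : i ≠ j.rev) (a : A) :
    (B.rootVector h𝒜 i j h a : Module.End Aᵐᵒᵖ X) = B.rootMap h𝒜 i j a := rfl

theorem component_ne_bot_iff_exists (h𝒜 : IsTorusWithInvolution 𝒜) (hξ : ξ.IsGradedForm 𝒜 𝓧)
    {ν : RootLattice r} (hν : ν ≠ 0) (τ : Γ) :
    B.component ν τ ≠ ⊥ ↔
      ∃ T : specialUnitary F ξ, (T : Module.End Aᵐᵒᵖ X) ∈ B.component ν τ ∧ T ≠ 0 := by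
  rw [Submodule.ne_bot_iff]
  constructor
  · rintro ⟨T, hT, h0⟩
    exact ⟨⟨T, B.component_le_specialUnitary h𝒜 hξ hν τ hT⟩, hT,
      fun h => h0 (congrArg Subtype.val h)⟩
  · rintro ⟨T, hT, h0⟩
    exact ⟨T, hT, fun h => h0 (Subtype.ext h)⟩

end Single

variable {A X Γ K : Type*} [AddCommGroup Γ] {L : AddSubgroup Γ}
  [Ring A] [Algebra F A] [StarRing A] [AddCommGroup X] [Module F X] [Module Aᵐᵒᵖ X]
  [IsScalarTower F Aᵐᵒᵖ X] {𝒜 : L → Submodule F A} {𝓧 : Γ → Submodule F X}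
  {ξ : HermitianForm A X} {B : CompatibleBasis r 𝒜 𝓧 ξ K}
  {A' X' Γ' K' : Type*} [AddCommGroup Γ'] {L' : AddSubgroup Γ'}
  [Ring A'] [Algebra F A'] [StarRing A'] [AddCommGroup X'] [Module F X'] [Module A'ᵐᵒᵖ X']
  [IsScalarTower F A'ᵐᵒᵖ X'] {𝒜' : L' → Submodule F A'} {𝓧' : Γ' → Submodule F X'}
  {ξ' : HermitianForm A' X'} {B' : CompatibleBasis r 𝒜' 𝓧' ξ' K'}
  {ψ : specialUnitary F ξ ≃ₗ⁅F⁆ specialUnitary F ξ'}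
  {ψr : RootLattice r ≃+ RootLattice r} {ψe : Γ ≃+ Γ'}
  (h𝒜 : IsTorusWithInvolution 𝒜) (hξ : ξ.IsGradedForm 𝒜 𝓧)
  (h𝒜' : IsTorusWithInvolution 𝒜') (hξ' : ξ'.IsGradedForm 𝒜' 𝓧')
  (hψ : ∀ μ σ, (B.specialUnitaryGrading μ σ).map
    (ψ.toLinearEquiv : specialUnitary F ξ →ₗ[F] specialUnitary F ξ') =
      B'.specialUnitaryGrading (ψr μ) (ψe σ))

section Roots

include hψ

theorem map_mem_component_iff (μ : RootLattice r) (σ : Γ) (T : specialUnitary F ξ) :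
    (ψ T : Module.End A'ᵐᵒᵖ X') ∈ B'.component (ψr μ) (ψe σ) ↔
      (T : Module.End Aᵐᵒᵖ X) ∈ B.component μ σ := by
  change ψ T ∈ B'.specialUnitaryGrading (ψr μ) (ψe σ) ↔ T ∈ B.specialUnitaryGrading μ σ
  rw [← hψ, Submodule.mem_map]
  constructor
  · rintro ⟨S, hS, hST⟩
    have : S = T := (EquivLike.injective ψ) hST
    rwa [← this]
  · exact fun hT => ⟨T, hT, rfl⟩

include h𝒜 hξ h𝒜' hξ'

theorem component_ne_bot_iff_map {μ : RootLattice r} (hμ : μ ≠ 0) (σ : Γ) :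
    B'.component (ψr μ) (ψe σ) ≠ ⊥ ↔ B.component μ σ ≠ ⊥ := by
  rw [B.component_ne_bot_iff_exists h𝒜 hξ hμ, B'.component_ne_bot_iff_exists h𝒜' hξ'
    ((map_ne_zero_iff _ ψr.injective).2 hμ)]
  constructor
  · rintro ⟨T, hT, h0⟩
    obtain ⟨S, rfl⟩ := (EquivLike.surjective ψ) T
    refine ⟨S, (map_mem_component_iff hψ _ _ _).1 hT, ?_⟩
    rintro rfl
    exact h0 (map_zero ψ)
  · rintro ⟨T, hT, h0⟩
    refine ⟨ψ T, (map_mem_component_iff hψ _ _ _).2 hT, fun h => h0 ((EquivLike.injective ψ) ?_)⟩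
    rw [h, map_zero]

/-- The roots `± ε_i ± ε_j`, `i ≠ j`, occur in degree `0` of `Γ`, hence so do their images. -/
theorem norm_map_le_two {i j : Fin (2 * r)} (hij : i ≠ j) (hij' : i ≠ j.rev) :
    ψr (weight (K := K) (Sum.inl i) + weight (K := K) (Sum.inl j)) ⬝ᵥ
      ψr (weight (K := K) (Sum.inl i) + weight (K := K) (Sum.inl j)) ≤ 2 := by
  refine B'.norm_le_two_of_component_ne_bot h𝒜' hξ' ?_
  have h := (component_ne_bot_iff_map h𝒜 hξ h𝒜' hξ' hψ (weight_add_ne_zero hij') 0).2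
    ((B.component_ne_bot_iff h𝒜 hξ hij hij' 0).2 L.zero_mem)
  rwa [map_zero] at h

/-- A bi-isomorphism permutes the short roots `± ε_i`: by the parallelogram law, if `u ± v` have
square norm at most `2` for nonzero `u` and `v` in the lattice, then `u` and `v` have norm `1`. -/
theorem exists_weight_eq_map (hr : 2 ≤ r) (i : Fin (2 * r)) :
    ∃ j, weight (K := K') (Sum.inl j) = ψr (weight (K := K) (Sum.inl i)) := by
  refine exists_weight_eq ?_
  obtain ⟨j, hij, hij'⟩ := exists_orthogonal hr i
  have h1 := norm_map_le_two h𝒜 hξ h𝒜' hξ' hψ hij hij'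
  have h2 := norm_map_le_two (j := j.rev) h𝒜 hξ h𝒜' hξ' hψ hij' (by rwa [Fin.rev_rev])
  have hpos : ∀ l, 0 < ψr (weight (K := K) (Sum.inl l)) ⬝ᵥ ψr (weight (K := K) (Sum.inl l)) := by
    intro l
    refine lt_of_le_of_ne (Finset.sum_nonneg fun _ _ => mul_self_nonneg _) fun h => ?_
    exact (map_ne_zero_iff _ ψr.injective).2 (weight_inl_ne_zero l)
      (dotProduct_self_eq_zero.1 h.symm)
  have hi := hpos i
  have hj := hpos j
  rw [weight_rev] at h2
  simp only [map_add, map_neg, add_dotProduct, dotProduct_add, neg_dotProduct,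
    dotProduct_neg] at h1 h2
  omega

end Roots

variable {π : Fin (2 * r) → Fin (2 * r)}
  (hπ : ∀ i, weight (K := K') (Sum.inl (π i)) = ψr (weight (K := K) (Sum.inl i)))

include hπ

theorem perm_ne {i j : Fin (2 * r)} (hij : i ≠ j) : π i ≠ π j := by
  intro h
  have h1 := hπ i
  rw [h, hπ j] at h1
  exact hij (Sum.inl_injective (eq_inl_of_weight_eq (ψr.injective h1))).symm

theorem perm_rev (i : Fin (2 * r)) : π i.rev = (π i).rev := by
  refine Sum.inl_injective (eq_inl_of_weight_eq (K := K') ?_)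
  rw [hπ, weight_rev, weight_rev, map_neg, hπ]

theorem perm_ne_rev {i j : Fin (2 * r)} (hij : i ≠ j.rev) : π i ≠ (π j).rev := by
  rw [← perm_rev hπ]
  exact perm_ne hπ hij

include hξ hξ' hψ in
/-- A bi-isomorphism carries the root vectors of root `± ε_i ± ε_j`, a copy of `A`, to those of
the image root. -/
theorem exists_linearMap {i j : Fin (2 * r)} (hij : i ≠ j) (hij' : i ≠ j.rev) :
    ∃ f : A →ₗ[F] A', ∀ a, (ψ (B.rootVector h𝒜 i j hij' a) : Module.End A'ᵐᵒᵖ X') =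
      B'.rootMap h𝒜' (π i) (π j) (f a) := by
  classical
  let f : A →ₗ[F] A' :=
    { toFun := fun a => coord B'.basis ((ψ (B.rootVector h𝒜 i j hij' a) : Module.End A'ᵐᵒᵖ X')
        (B'.basis (Sum.inl (π j).rev))) (Sum.inl (π i))
      map_add' := fun a b => by
        simp only [map_add]; simp [coord_add]
      map_smul' := fun c a => by
        simp only [map_smul]; simp [coord_smul_field] }
  refine ⟨f, fun a => ?_⟩
  refine h𝒜.induction_on (p := fun a =>
    (ψ (B.rootVector h𝒜 i j hij' a) : Module.End A'ᵐᵒᵖ X') = B'.rootMap h𝒜' (π i) (π j) (f a))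
    a ?_ ?_
  · intro l a ha
    rw [← extendGrading_coe 𝒜 l, ← B.rootMap_mem_component_iff h𝒜 hξ hij hij',
      ← B.coe_rootVector h𝒜 hij', ← map_mem_component_iff hψ, map_add, ← hπ, ← hπ,
      B'.component_weight_add h𝒜' hξ' (perm_ne hπ hij) (perm_ne_rev hπ hij')] at ha
    obtain ⟨b, -, hb⟩ := ha
    have : f a = b := by
      change coord B'.basis ((ψ (B.rootVector h𝒜 i j hij' a) : Module.End A'ᵐᵒᵖ X')
        (B'.basis (Sum.inl (π j).rev))) (Sum.inl (π i)) = b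
      rw [← hb, rootMap_apply_basis B' h𝒜' (perm_ne hπ hij), coord_smul, coord_self]
      simp
    rw [this, ← hb]
  · intro a b ha hb
    simp only [map_add] at ha hb ⊢
    rw [AddMemClass.coe_add, ha, hb]

/-! ### The linear maps between root spaces -/

section Entry

variable {i j : Fin (2 * r)} (hij : i ≠ j) (hij' : i ≠ j.rev) {f : A →ₗ[F] A'}
  (hf : ∀ a, (ψ (B.rootVector h𝒜 i j hij' a) : Module.End A'ᵐᵒᵖ X') =
      B'.rootMap h𝒜' (π i) (π j) (f a))

include hξ hξ' hψ hij hf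

theorem entry_mem_iff (σ : Γ) (a : A) :
    f a ∈ extendGrading 𝒜' (ψe σ) ↔ a ∈ extendGrading 𝒜 σ := by
  rw [← B'.rootMap_mem_component_iff h𝒜' hξ' (perm_ne hπ hij) (perm_ne_rev hπ hij'), ← hf, hπ, hπ,
    ← map_add, map_mem_component_iff hψ, coe_rootVector, B.rootMap_mem_component_iff h𝒜 hξ hij hij']

omit hξ hξ' hψ hπ in
theorem entry_injective : Function.Injective f := by
  intro a b hab
  have h := hf a
  rw [hab, ← hf b] at h
  have h2 := congrArg Subtype.val ((EquivLike.injective ψ) (Subtype.ext h))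
  exact B.rootMap_injective h𝒜 hij h2

theorem entry_surjective : Function.Surjective f := by
  intro a'
  suffices h : a' ∈ LinearMap.range f from h
  refine h𝒜'.induction_on (p := fun a' => a' ∈ LinearMap.range f) a' ?_
    fun a b ha hb => add_mem ha hb
  intro l b hb
  obtain ⟨σ, hσ⟩ := ψe.surjective (l : Γ')
  rw [← extendGrading_coe 𝒜' l, ← B'.rootMap_mem_component_iff h𝒜' hξ' (perm_ne hπ hij)
    (perm_ne_rev hπ hij'), ← B'.coe_rootVector h𝒜' (perm_ne_rev hπ hij')] at hb
  obtain ⟨T, hT⟩ := (EquivLike.surjective ψ) (B'.rootVector h𝒜' (π i) (π j) (perm_ne_rev hπ hij') b)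
  rw [← hT, ← hσ, hπ, hπ, ← map_add, map_mem_component_iff hψ,
    B.component_weight_add h𝒜 hξ hij hij'] at hb
  obtain ⟨a, -, ha⟩ := hb
  have hTa : T = B.rootVector h𝒜 i j hij' a := Subtype.ext ha.symm
  refine ⟨a, B'.rootMap_injective h𝒜' (perm_ne hπ hij) ?_⟩
  rw [← hf, ← hTa, hT, coe_rootVector]

theorem entry_one : ∃ c : F, c ≠ 0 ∧ f 1 = c • 1 := by
  have := h𝒜.nontrivial
  have h1 := (entry_mem_iff h𝒜 hξ h𝒜' hξ' hψ hπ hij hij' hf 0 1).2 h𝒜.one_mem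
  rw [map_zero] at h1
  obtain ⟨c, hc⟩ := h𝒜'.exists_eq_smul_one h1
  refine ⟨c, ?_, hc⟩
  rintro rfl
  rw [zero_smul, ← map_zero f] at hc
  exact one_ne_zero (entry_injective h𝒜 h𝒜' hij hij' hf hc)

end Entry

/-- Some linear map `f_ij` induced by a bi-isomorphism on a root space becomes, after division by
the scalar `f_ij(1)`, a homomorphism of algebras with involution. The product rule
`f_ik(ab) = f_ij̄(a) f_jk(b)` makes the normalized maps for indices `0`, `1`, `2` agree where needed. -/
theorem exists_normalized {f : Fin (2 * r) → Fin (2 * r) → A →ₗ[F] A'}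
    (hf : ∀ i j, i ≠ j → ∀ h : i ≠ j.rev, ∀ a,
      (ψ (B.rootVector h𝒜 i j h a) : Module.End A'ᵐᵒᵖ X') = B'.rootMap h𝒜' (π i) (π j) (f i j a))
    (hone : ∀ i j, i ≠ j → i ≠ j.rev → ∃ c : F, c ≠ 0 ∧ f i j 1 = c • 1)
    (hr : 3 ≤ r) :
    ∃ i j, i ≠ j ∧ i ≠ j.rev ∧ ∃ c : F, c ≠ 0 ∧
      (c • f i j) 1 = 1 ∧ (∀ a b, (c • f i j) (a * b) = (c • f i j) a * (c • f i j) b) ∧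
      ∀ a, (c • f i j) (star a) = star ((c • f i j) a) := by
  have rev_ne : ∀ {i j : Fin (2 * r)}, i ≠ j.rev → i.rev ≠ j := fun h h' =>
    h (by rw [← h', Fin.rev_rev])
  have mul : ∀ {i j k : Fin (2 * r)}, i ≠ j → i ≠ j.rev → k ≠ j → k ≠ j.rev → i ≠ k → i ≠ k.rev →
      ∀ a b, f i k (a * b) = f i j.rev a * f j k b := by
    intro i j k hij hij' hkj hkj' hik hik' a b
    have hjk' : j ≠ k.rev := fun h => hkj' (by rw [h, Fin.rev_rev])
    have hijr : i ≠ j.rev.rev := by rwa [Fin.rev_rev]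
    refine B'.rootMap_injective h𝒜' (perm_ne hπ hik) ?_
    rw [← hf i k hik hik', ← B'.bracket_rootMap h𝒜' (perm_ne_rev hπ hij') (perm_ne hπ hkj)
      (perm_ne_rev hπ hik'), ← perm_rev hπ, ← hf i j.rev hij' hijr, ← hf j k hkj.symm hjk',
      ← LieSubalgebra.coe_bracket, ← LieEquiv.map_lie]
    congr 2
    refine Subtype.ext ?_
    rw [LieSubalgebra.coe_bracket, coe_rootVector, coe_rootVector, coe_rootVector,
      B.bracket_rootMap h𝒜 hij' hkj hik']
  have hstar : ∀ {i j : Fin (2 * r)}, i ≠ j → i ≠ j.rev → ∀ a,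
      f j i (star a) = star (f i j a) := by
    intro i j hij hij' a
    have hji' : j ≠ i.rev := fun h => hij' (by rw [h, Fin.rev_rev])
    refine B'.rootMap_injective h𝒜' (perm_ne hπ hij.symm) ?_
    rw [← hf j i hij.symm hji', rootMap_swap, ← hf i j hij hij', ← NegMemClass.coe_neg,
      ← map_neg]
    congr 2
    refine Subtype.ext ?_
    rw [NegMemClass.coe_neg, coe_rootVector, coe_rootVector, rootMap_swap]
  choose! c hc0 hc using hone
  -- Setting one factor of the product rule equal to `1` compares two entries.
  have compare : ∀ {i j k : Fin (2 * r)}, i ≠ j → i ≠ j.rev → k ≠ j → k ≠ j.rev → i ≠ k →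
      i ≠ k.rev → ∀ a, (c i k)⁻¹ • f i k a = (c i j.rev)⁻¹ • f i j.rev a ∧
        (c i k)⁻¹ • f i k a = (c j k)⁻¹ • f j k a := by
    intro i j k hij hij' hkj hkj' hik hik' a
    have := h𝒜'.nontrivial
    have hjk' : j ≠ k.rev := fun h => hkj' (by rw [h, Fin.rev_rev])
    have hijr : i ≠ j.rev.rev := by rwa [Fin.rev_rev]
    have h1 : f i k a = c j k • f i j.rev a := by
      have := mul hij hij' hkj hkj' hik hik' a 1
      rwa [mul_one, hc j k hkj.symm hjk', mul_smul_comm, mul_one] at this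
    have h2 : f i k a = c i j.rev • f j k a := by
      have := mul hij hij' hkj hkj' hik hik' 1 a
      rwa [one_mul, hc i j.rev hij' hijr, smul_mul_assoc, one_mul] at this
    have h3 : c i k = c i j.rev * c j k := by
      have := mul hij hij' hkj hkj' hik hik' 1 1
      rw [one_mul, hc i k hik hik', hc i j.rev hij' hijr, hc j k hkj.symm hjk', smul_mul_smul_comm,
        one_mul] at this
      exact smul_left_injective F one_ne_zero this
    have n1 := hc0 i j.rev hij' hijr
    have n2 := hc0 j k hkj.symm hjk'
    constructor
    · rw [h1, h3, smul_smul]; congr 1; field_simp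
    · rw [h2, h3, smul_smul]; congr 1; field_simp
  let e : Fin 3 → Fin (2 * r) := fun a => Fin.castLE (by omega) (Fin.castLE hr a)
  have he : ∀ {a b : Fin 3}, a ≠ b → e a ≠ e b := fun h => castLE_ne (by simpa using h)
  have he' : ∀ a b : Fin 3, e a ≠ (e b).rev := fun a b => castLE_ne_rev _ _
  have h01 : e 0 ≠ e 1 := he (by decide)
  have h02 : e 0 ≠ e 2 := he (by decide)
  have h12 : e 1 ≠ e 2 := he (by decide)
  refine ⟨e 0, e 1, h01, he' _ _, (c (e 0) (e 1))⁻¹, inv_ne_zero (hc0 _ _ h01 (he' _ _)),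
    ?_, ?_, ?_⟩
  · rw [LinearMap.smul_apply, hc _ _ h01 (he' _ _), smul_smul,
      inv_mul_cancel₀ (hc0 _ _ h01 (he' _ _)), one_smul]
  · intro a b
    have ha := (compare h02 (he' _ _) h12 (he' _ _) h01 (he' _ _) a).1
    have hb := (compare h02 (he' _ _) h12 (he' _ _) h01 (he' _ _) b).2
    simp only [LinearMap.smul_apply]
    have hm := mul h02 (he' _ _) h12 (he' _ _) h01 (he' _ _) a b
    have h3 : c (e 0) (e 1) = c (e 0) (e 2).rev * c (e 2) (e 1) := by
      have := h𝒜'.nontrivial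
      have := mul h02 (he' _ _) h12 (he' _ _) h01 (he' _ _) 1 1
      rw [one_mul, hc _ _ h01 (he' _ _), hc _ (e 2).rev (he' _ _) (by rwa [Fin.rev_rev]),
        hc _ _ h12.symm (he' _ _), smul_mul_smul_comm, one_mul] at this
      exact smul_left_injective F one_ne_zero this
    rw [ha, hb, hm, h3, smul_mul_smul_comm, mul_inv]
  · intro a
    -- The normalized entries at `(0, 1)` and `(1, 0)` agree through those at `(2, 1)` and `(2, 0)`.
    have e1 : ∀ x, (c (e 0) (e 1))⁻¹ • f (e 0) (e 1) x = (c (e 2) (e 1))⁻¹ • f (e 2) (e 1) x :=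
      fun x => (compare h02 (he' _ _) h12 (he' _ _) h01 (he' _ _) x).2
    have e2 : ∀ x, (c (e 2) (e 1))⁻¹ • f (e 2) (e 1) x = (c (e 2) (e 0))⁻¹ • f (e 2) (e 0) x := by
      intro x
      have := (compare (i := e 2) (j := (e 0).rev) (k := e 1) (he' _ _)
        (by rw [Fin.rev_rev]; exact h02.symm) (he' _ _) (by rw [Fin.rev_rev]; exact h01.symm)
        h12.symm (he' _ _) x).1
      rwa [Fin.rev_rev] at this
    have e3 : ∀ x, (c (e 2) (e 0))⁻¹ • f (e 2) (e 0) x = (c (e 1) (e 0))⁻¹ • f (e 1) (e 0) x :=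
      fun x => (compare h12.symm (he' _ _) h01 (he' _ _) h02.symm (he' _ _) x).2
    have hcc : c (e 1) (e 0) = c (e 0) (e 1) := by
      have := h𝒜'.nontrivial
      have h := hstar h01 (he' _ _) 1
      rw [star_one, hc _ _ h01 (he' _ _), hc _ _ h01.symm (he' _ _), h𝒜'.star_smul_one] at h
      exact smul_left_injective F one_ne_zero h
    simp only [LinearMap.smul_apply]
    rw [e1, e2, e3, hcc, hstar h01 (he' _ _), h𝒜'.star_smul]

/-- The restriction to `L` of an isomorphism `Γ ≃ Γ'` carrying `L` onto `L'`. -/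
def restrictEquiv (ψe : Γ ≃+ Γ') (hL : ∀ σ, ψe σ ∈ L' ↔ σ ∈ L) : L ≃+ L' where
  toFun l := ⟨ψe l, (hL _).2 l.2⟩
  invFun l := ⟨ψe.symm l, (hL _).1 (by simp)⟩
  left_inv l := by ext; simp
  right_inv l := by ext; simp
  map_add' l m := by ext; simp

omit hπ in
theorem restrictEquiv_image_twiceSupp (ψe : Γ ≃+ Γ') (hL : ∀ σ, ψe σ ∈ L' ↔ σ ∈ L)
    (hs : ∀ σ, ψe σ ∈ supp 𝓧' ↔ σ ∈ supp 𝓧) :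
    restrictEquiv ψe hL '' twiceSupp L 𝓧 = twiceSupp L' 𝓧' := by
  ext l
  constructor
  · rintro ⟨a, ⟨σ, hσ, ha⟩, rfl⟩
    exact ⟨ψe σ, (hs σ).2 hσ, by change ψe a = _; rw [ha, map_nsmul]⟩
  · rintro ⟨σ, hσ, hl⟩
    obtain ⟨σ, rfl⟩ := ψe.surjective σ
    obtain ⟨a, rfl⟩ := (restrictEquiv ψe hL).surjective l
    refine ⟨a, ⟨σ, (hs σ).1 hσ, ψe.injective ?_⟩, rfl⟩
    rw [map_nsmul]; exact hl

omit hπ in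
include h𝒜 hξ h𝒜' hξ' in
/-- A bi-isomorphism of special unitary Lie algebras of rank at least `3` yields an isograded
isomorphism of the coordinate tori that respects the supports. -/
theorem exists_isogradedIso (hr : 3 ≤ r)
    (h : BiIsomorphic B.specialUnitaryGrading B'.specialUnitaryGrading) :
    ∃ φ : IsogradedIso 𝒜 𝒜', φ.gr '' twiceSupp L 𝓧 = twiceSupp L' 𝓧' := by
  obtain ⟨ψ, ψr, ψe, hψ⟩ := h
  choose π hπ using exists_weight_eq_map h𝒜 hξ h𝒜' hξ' hψ (by omega)
  have hex : ∀ i j, ∃ f : A →ₗ[F] A', i ≠ j → ∀ h : i ≠ j.rev, ∀ a,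
      (ψ (B.rootVector h𝒜 i j h a) : Module.End A'ᵐᵒᵖ X') =
        B'.rootMap h𝒜' (π i) (π j) (f a) := by
    intro i j
    by_cases hij : i ≠ j ∧ i ≠ j.rev
    · obtain ⟨f, hf⟩ := exists_linearMap h𝒜 hξ h𝒜' hξ' hψ hπ hij.1 hij.2
      exact ⟨f, fun _ _ => hf⟩
    · exact ⟨0, fun h1 h2 => absurd ⟨h1, h2⟩ hij⟩
  choose f hf using hex
  obtain ⟨i, j, hij, hij', c, hc0, hone, hmul, hstar⟩ := exists_normalized h𝒜 h𝒜' hπ hf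
    (fun i j hij hij' => entry_one h𝒜 hξ h𝒜' hξ' hψ hπ hij hij' (hf i j hij hij')) hr
  have hmem := entry_mem_iff h𝒜 hξ h𝒜' hξ' hψ hπ hij hij' (hf i j hij hij')
  have hinj := entry_injective h𝒜 h𝒜' hij hij' (hf i j hij hij')
  have hsur := entry_surjective h𝒜 hξ h𝒜' hξ' hψ hπ hij hij' (hf i j hij hij')
  have hbij : Function.Bijective (c • f i j) := by
    constructor
    · intro a b hab
      exact hinj (smul_right_injective _ hc0 hab)
    · intro b
      obtain ⟨a, ha⟩ := hsur (c⁻¹ • b)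
      exact ⟨a, by rw [LinearMap.smul_apply, ha, smul_smul, mul_inv_cancel₀ hc0, one_smul]⟩
  have hmem' : ∀ σ a, (c • f i j) a ∈ extendGrading 𝒜' (ψe σ) ↔ a ∈ extendGrading 𝒜 σ := by
    intro σ a
    rw [← hmem, LinearMap.smul_apply, Submodule.smul_mem_iff _ hc0]
  have hL : ∀ σ, ψe σ ∈ L' ↔ σ ∈ L := by
    intro σ
    rw [← B.component_ne_bot_iff h𝒜 hξ hij hij',
      ← component_ne_bot_iff_map h𝒜 hξ h𝒜' hξ' hψ (weight_add_ne_zero hij'), map_add, ← hπ, ← hπ,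
      B'.component_ne_bot_iff h𝒜' hξ' (perm_ne hπ hij) (perm_ne_rev hπ hij')]
  have hs : ∀ σ, ψe σ ∈ supp 𝓧' ↔ σ ∈ supp 𝓧 := by
    intro σ
    rw [← B.component_weight_ne_bot_iff h𝒜 hξ i,
      ← component_ne_bot_iff_map h𝒜 hξ h𝒜' hξ' hψ (weight_inl_ne_zero i), ← hπ,
      B'.component_weight_ne_bot_iff h𝒜' hξ']
  let φ : A ≃ₐ[F] A' := AlgEquiv.ofBijective (AlgHom.ofLinearMap (c • f i j) hone hmul) hbij
  have hφ : ∀ a, φ a = (c • f i j) a := fun _ => rfl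
  refine ⟨⟨φ, restrictEquiv ψe hL, hstar, fun σ => ?_⟩, restrictEquiv_image_twiceSupp ψe hL hs⟩
  ext b
  obtain ⟨a, rfl⟩ := φ.surjective b
  rw [← extendGrading_coe 𝒜', ← extendGrading_coe 𝒜, hφ]
  refine Iff.trans ?_ (hmem' σ a).symm
  constructor
  · rintro ⟨b, hb, hab⟩
    rwa [← hbij.1 hab]
  · exact fun ha => ⟨a, ha, rfl⟩

end CompatibleBasis

/-! ### Bi-isomorphisms from semilinear isometries -/

section Isometry

variable {F A X Γ K : Type*} [Field F] [AddCommGroup Γ] {L : AddSubgroup Γ}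
  [Ring A] [Algebra F A] [StarRing A] [AddCommGroup X] [Module F X] [Module Aᵐᵒᵖ X]
  [IsScalarTower F Aᵐᵒᵖ X] {𝒜 : L → Submodule F A} {𝓧 : Γ → Submodule F X}
  {ξ : HermitianForm A X}
  {A' X' Γ' K' : Type*} [AddCommGroup Γ'] {L' : AddSubgroup Γ'}
  [Ring A'] [Algebra F A'] [StarRing A'] [AddCommGroup X'] [Module F X'] [Module A'ᵐᵒᵖ X']
  [IsScalarTower F A'ᵐᵒᵖ X'] {𝒜' : L' → Submodule F A'} {𝓧' : Γ' → Submodule F X'}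
  {ξ' : HermitianForm A' X'}

/-- A bijective isometry `X → X'`, semilinear with respect to an algebra isomorphism
`φ : A → A'`. -/
structure SemilinearIsometry (φ : A ≃ₐ[F] A') (ξ : HermitianForm A X) (ξ' : HermitianForm A' X')
    extends X ≃+ X' where
  map_smul_right : ∀ x (a : A), toAddEquiv (x <• a) = toAddEquiv x <• φ a
  map_form : ∀ x y, ξ' (toAddEquiv x) (toAddEquiv y) = φ (ξ x y)

namespace SemilinearIsometry

variable {φ : A ≃ₐ[F] A'} (T : SemilinearIsometry φ ξ ξ')

theorem symm_smul_right (x : X') (a : A') :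
    T.toAddEquiv.symm (x <• a) = T.toAddEquiv.symm x <• φ.symm a := by
  rw [AddEquiv.symm_apply_eq, T.map_smul_right]
  simp

theorem map_smul_field (c : F) (x : X) : T.toAddEquiv (c • x) = c • T.toAddEquiv x := by
  rw [← smul_one_right (A := A), T.map_smul_right, map_smul, map_one, smul_one_right]

/-- Conjugation of endomorphisms by a semilinear isometry. -/
def conj : Module.End Aᵐᵒᵖ X ≃ₐ[F] Module.End A'ᵐᵒᵖ X' where
  toFun f :=
    { toFun := fun z => T.toAddEquiv (f (T.toAddEquiv.symm z))
      map_add' := fun z w => by rw [map_add, map_add, map_add]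
      map_smul' := fun a z => by
        have h := T.symm_smul_right z a.unop
        rw [MulOpposite.op_unop] at h
        rw [h, map_smul, T.map_smul_right, AlgEquiv.apply_symm_apply, MulOpposite.op_unop]
        rfl }
  invFun f :=
    { toFun := fun z => T.toAddEquiv.symm (f (T.toAddEquiv z))
      map_add' := fun z w => by rw [map_add, map_add, map_add]
      map_smul' := fun a z => by
        have h := T.map_smul_right z a.unop
        rw [MulOpposite.op_unop] at h
        rw [h, map_smul, T.symm_smul_right, AlgEquiv.symm_apply_apply, MulOpposite.op_unop]
        rfl }
  left_inv f := by ext z; simp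
  right_inv f := by ext z; simp
  map_mul' f g := by ext z; simp
  map_add' f g := by ext z; simp
  commutes' c := by
    ext z
    simp only [Module.algebraMap_end_apply, LinearMap.coe_mk, AddHom.coe_mk, T.map_smul_field,
      AddEquiv.apply_symm_apply]

theorem conj_apply (f : Module.End Aᵐᵒᵖ X) (x : X) :
    T.conj f (T.toAddEquiv x) = T.toAddEquiv (f x) := by
  change T.toAddEquiv (f (T.toAddEquiv.symm (T.toAddEquiv x))) = _
  rw [AddEquiv.symm_apply_apply]

theorem conj_U (x y : X) : T.conj (ξ.U x y) = ξ'.U (T.toAddEquiv x) (T.toAddEquiv y) := by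
  ext z
  obtain ⟨z, rfl⟩ := T.toAddEquiv.surjective z
  rw [conj_apply, HermitianForm.U_apply, HermitianForm.U_apply, map_sub, T.map_smul_right,
    T.map_smul_right, T.map_form, T.map_form]

theorem map_finiteUnitary :
    (finiteUnitary F ξ).toSubmodule.map T.conj.toLinearMap = (finiteUnitary F ξ').toSubmodule := by
  change (Submodule.span F _).map _ = Submodule.span F _
  rw [Submodule.map_span]
  congr 1
  ext S
  constructor
  · rintro ⟨_, ⟨x, y, rfl⟩, rfl⟩
    exact ⟨_, _, T.conj_U x y⟩
  · rintro ⟨x, y, rfl⟩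
    obtain ⟨x, rfl⟩ := T.toAddEquiv.surjective x
    obtain ⟨y, rfl⟩ := T.toAddEquiv.surjective y
    exact ⟨_, ⟨x, y, rfl⟩, T.conj_U x y⟩

theorem conj_mem_finiteUnitary_iff (S : Module.End Aᵐᵒᵖ X) :
    T.conj S ∈ finiteUnitary F ξ' ↔ S ∈ finiteUnitary F ξ := by
  rw [← LieSubalgebra.mem_toSubmodule, ← LieSubalgebra.mem_toSubmodule, ← T.map_finiteUnitary]
  exact T.conj.injective.mem_set_image

theorem map_specialUnitary :
    (specialUnitary F ξ).toSubmodule.map T.conj.toLinearMap =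
      (specialUnitary F ξ').toSubmodule := by
  change (Submodule.span F _).map _ = Submodule.span F _
  have hbr : ∀ S R : Module.End Aᵐᵒᵖ X, T.conj ⁅S, R⁆ = ⁅T.conj S, T.conj R⁆ := fun S R => by
    simp [LieRing.of_associative_ring_bracket]
  rw [Submodule.map_span]
  congr 1
  ext S
  constructor
  · rintro ⟨_, ⟨P, hP, Q, hQ, rfl⟩, rfl⟩
    exact ⟨_, (T.conj_mem_finiteUnitary_iff P).2 hP, _, (T.conj_mem_finiteUnitary_iff Q).2 hQ,
      hbr P Q⟩
  · rintro ⟨P, hP, Q, hQ, rfl⟩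
    obtain ⟨P, rfl⟩ := T.conj.surjective P
    obtain ⟨Q, rfl⟩ := T.conj.surjective Q
    exact ⟨_, ⟨P, (T.conj_mem_finiteUnitary_iff P).1 hP, Q, (T.conj_mem_finiteUnitary_iff Q).1 hQ,
      rfl⟩, hbr P Q⟩

variable {r : ℕ} {B : CompatibleBasis r 𝒜 𝓧 ξ K} {B' : CompatibleBasis r 𝒜' 𝓧' ξ' K'}
  {ψe : Γ ≃+ Γ'}
  (hT : ∀ j, T.toAddEquiv (B.basis (Sum.inl j)) = B'.basis (Sum.inl j))
  (hgr : ∀ σ x, T.toAddEquiv x ∈ 𝓧' (ψe σ) ↔ x ∈ 𝓧 σ)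

include hT

theorem mem_weightSpace_iff (lam : RootLattice r) (x : X) :
    T.toAddEquiv x ∈ B'.weightSpace lam ↔ x ∈ B.weightSpace lam := by
  have hh : ∀ i, B'.h i = T.conj (B.h i) := by
    intro i
    have hb : bar (K := K) (Sum.inl (Fin.castLE (by omega) i)) =
        Sum.inl (Fin.castLE (by omega) i : Fin (2 * r)).rev := rfl
    have hb' : bar (K := K') (Sum.inl (Fin.castLE (by omega) i)) =
        Sum.inl (Fin.castLE (by omega) i : Fin (2 * r)).rev := rfl
    simp only [CompatibleBasis.h, conj_U, hb, hb', hT]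
  change (∀ i, B'.h i (T.toAddEquiv x) = lam i • T.toAddEquiv x) ↔ ∀ i, B.h i x = lam i • x
  refine forall_congr' fun i => ?_
  rw [hh, conj_apply, ← map_zsmul, T.toAddEquiv.injective.eq_iff]

include hgr

theorem map_component (ν : RootLattice r) (τ : Γ) :
    (B.component ν τ).map T.conj.toLinearMap = B'.component ν (ψe τ) := by
  rw [CompatibleBasis.component, CompatibleBasis.component, Submodule.map_span]
  congr 1
  ext S
  constructor
  · rintro ⟨_, ⟨lam, μ, ρ, σ, x, y, hν, rfl, ⟨hx, hx'⟩, ⟨hy, hy'⟩, rfl⟩, rfl⟩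
    exact ⟨lam, μ, ψe ρ, ψe σ, _, _, hν, (map_add _ _ _).symm,
      ⟨(T.mem_weightSpace_iff hT _ _).2 hx, (hgr _ _).2 hx'⟩,
      ⟨(T.mem_weightSpace_iff hT _ _).2 hy, (hgr _ _).2 hy'⟩, T.conj_U x y⟩
  · rintro ⟨lam, μ, ρ, σ, x, y, hν, hτ, ⟨hx, hx'⟩, ⟨hy, hy'⟩, rfl⟩
    obtain ⟨x, rfl⟩ := T.toAddEquiv.surjective x
    obtain ⟨y, rfl⟩ := T.toAddEquiv.surjective y
    obtain ⟨ρ, rfl⟩ := ψe.surjective ρ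
    obtain ⟨σ, rfl⟩ := ψe.surjective σ
    rw [← map_add, ψe.injective.eq_iff] at hτ
    exact ⟨_, ⟨lam, μ, ρ, σ, x, y, hν, hτ,
      ⟨(T.mem_weightSpace_iff hT _ _).1 hx, (hgr _ _).1 hx'⟩,
      ⟨(T.mem_weightSpace_iff hT _ _).1 hy, (hgr _ _).1 hy'⟩, rfl⟩, T.conj_U x y⟩

/-- Conjugation by a graded semilinear isometry that preserves the hyperbolic basis vectors is a
bi-isomorphism; it is the identity on the root lattices. -/
theorem biIsomorphic_of_map_eq {M : LieSubalgebra F (Module.End Aᵐᵒᵖ X)}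
    {M' : LieSubalgebra F (Module.End A'ᵐᵒᵖ X')}
    (hM : M.toSubmodule.map T.conj.toLinearMap = M'.toSubmodule) :
    BiIsomorphic (fun ν τ => (B.component ν τ).comap M.toSubmodule.subtype :
        RootLattice r → Γ → Submodule F M)
      (fun ν τ => (B'.component ν τ).comap M'.toSubmodule.subtype :
        RootLattice r → Γ' → Submodule F M') := by
  have hM' : M.map (T.conj.toLieEquiv : Module.End Aᵐᵒᵖ X →ₗ⁅F⁆ Module.End A'ᵐᵒᵖ X') = M' := by
    apply LieSubalgebra.toSubmodule_injective
    exact hM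
  refine ⟨LieEquiv.ofSubalgebras M M' T.conj.toLieEquiv hM', AddEquiv.refl _, ψe, fun ν τ => ?_⟩
  ext S
  change _ ↔ (S : Module.End A'ᵐᵒᵖ X') ∈ B'.component ν (ψe τ)
  rw [← T.map_component hT hgr]
  constructor
  · rintro ⟨R, hR, rfl⟩
    exact ⟨R, hR, rfl⟩
  · rintro ⟨R, hR, hRS⟩
    have hRM : R ∈ M := by
      have hS : (S : Module.End A'ᵐᵒᵖ X') ∈ M'.toSubmodule := S.2
      rw [← hM, ← hRS] at hS
      exact (T.conj.injective.mem_set_image).1 hS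
    exact ⟨⟨R, hRM⟩, hR, Subtype.ext hRS⟩

theorem biIsomorphic_finiteUnitary :
    BiIsomorphic B.finiteUnitaryGrading B'.finiteUnitaryGrading :=
  T.biIsomorphic_of_map_eq hT hgr T.map_finiteUnitary

theorem biIsomorphic_specialUnitary :
    BiIsomorphic B.specialUnitaryGrading B'.specialUnitaryGrading :=
  T.biIsomorphic_of_map_eq hT hgr T.map_specialUnitary

end SemilinearIsometry

/-- A bijection between bases that is compatible with the forms extends to a semilinear
isometry. -/
theorem exists_semilinearIsometry {ι : Type*} (φ : A ≃ₐ[F] A')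
    (hstar : ∀ a, φ (star a) = star (φ a))
    (b : Module.Basis ι Aᵐᵒᵖ X) (b' : Module.Basis ι A'ᵐᵒᵖ X')
    (hform : ∀ p q, ξ' (b' p) (b' q) = φ (ξ (b p) (b q))) :
    ∃ T : SemilinearIsometry φ ξ ξ', ∀ x p, coord b' (T.toAddEquiv x) p = φ (coord b x p) := by
  let φop : Aᵐᵒᵖ ≃+ A'ᵐᵒᵖ := MulOpposite.opAddEquiv.symm.trans
    (φ.toAddEquiv.trans MulOpposite.opAddEquiv)
  let T : X ≃+ X' := (b.repr.toAddEquiv.trans (Finsupp.mapRange.addEquiv φop)).trans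
    b'.repr.symm.toAddEquiv
  have hcoord : ∀ x p, coord b' (T x) p = φ (coord b x p) := by
    intro x p
    change (b'.repr (b'.repr.symm _) p).unop = _
    rw [LinearEquiv.apply_symm_apply]
    rfl
  have hsmul : ∀ x (a : A), T (x <• a) = T x <• φ a := by
    intro x a
    refine ext_coord b' fun p => ?_
    rw [hcoord, coord_smul, coord_smul, map_mul, hcoord]
  have hb : ∀ p, T (b p) = b' p := by
    classical
    intro p
    refine ext_coord b' fun q => ?_
    rw [hcoord, coord_self, coord_self]
    split_ifs <;> simp
  refine ⟨⟨T, hsmul, fun x y => ?_⟩, hcoord⟩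
  induction b.mem_span x using Submodule.span_induction with
  | zero => simp [HermitianForm.zero_left]
  | add x x' _ _ hx hx' => rw [map_add, ξ'.add_left, ξ.add_left, map_add, hx, hx']
  | smul a x _ hx =>
    have := hsmul x a.unop
    rw [MulOpposite.op_unop] at this
    have h2 := ξ.smul_left a.unop x y
    rw [MulOpposite.op_unop] at h2
    rw [this, ξ'.smul_left, hx, h2, map_mul, hstar]
  | mem x hx =>
    obtain ⟨p, rfl⟩ := hx
    induction b.mem_span y using Submodule.span_induction with
    | zero => simp [HermitianForm.zero_right]
    | add x x' _ _ hx hx' => rw [map_add, ξ'.add_right, ξ.add_right, map_add, hx, hx']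
    | smul a x _ hx =>
      have := hsmul x a.unop
      rw [MulOpposite.op_unop] at this
      have h2 := ξ.smul_right a.unop (b p) x
      rw [MulOpposite.op_unop] at h2
      rw [this, ξ'.smul_right, hx, h2, map_mul]
    | mem y hy =>
      obtain ⟨q, rfl⟩ := hy
      rw [hb, hb, hform]

end Isometry

/-! ### Extending the isomorphism of grading groups -/

section Groups

variable {F Γ Γ' : Type*} [Field F] [AddCommGroup Γ] {L : AddSubgroup Γ} [AddCommGroup Γ']
  {L' : AddSubgroup Γ'}
  {X X' : Type*} [AddCommGroup X] [Module F X] [AddCommGroup X'] [Module F X']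
  {𝓧 : Γ → Submodule F X} {𝓧' : Γ' → Submodule F X'}

theorem twice_injective (hΓ : ∀ σ : Γ, 2 • σ = 0 → σ = 0) {σ τ : Γ} (h : 2 • σ = 2 • τ) :
    σ = τ := by
  rw [← sub_eq_zero]
  exact hΓ _ (by rw [smul_sub, h, sub_self])

theorem twice_mem_of_closure (h2 : ∀ σ ∈ supp 𝓧, 2 • σ ∈ L)
    (hcl : AddSubgroup.closure (supp 𝓧) = ⊤) (σ : Γ) : 2 • σ ∈ L := by
  have hσ : σ ∈ AddSubgroup.closure (supp 𝓧) := by rw [hcl]; trivial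
  induction hσ using AddSubgroup.closure_induction with
  | mem σ hσ => exact h2 σ hσ
  | zero => simp
  | add σ τ _ _ hσ hτ => rw [smul_add]; exact L.add_mem hσ hτ
  | neg σ _ hσ => rw [smul_neg]; exact L.neg_mem hσ

theorem exists_twice_eq (h2 : ∀ σ : Γ, 2 • σ ∈ L) (hcl : AddSubgroup.closure (supp 𝓧) = ⊤)
    (gr : L ≃+ L') (hgr : ∀ a ∈ twiceSupp L 𝓧, gr a ∈ twiceSupp L' 𝓧') (σ : Γ) :
    ∃ σ' : Γ', 2 • σ' = (gr ⟨2 • σ, h2 σ⟩ : Γ') := by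
  have hσ : σ ∈ AddSubgroup.closure (supp 𝓧) := by rw [hcl]; trivial
  induction hσ using AddSubgroup.closure_induction with
  | mem σ hσ =>
    obtain ⟨σ', -, h⟩ := hgr ⟨2 • σ, h2 σ⟩ ⟨σ, hσ, rfl⟩
    exact ⟨σ', h.symm⟩
  | zero =>
    refine ⟨0, ?_⟩
    have : (⟨2 • (0 : Γ), h2 0⟩ : L) = 0 := by ext; simp
    rw [this]; simp
  | add σ τ _ _ hσ hτ =>
    obtain ⟨σ', hσ'⟩ := hσ
    obtain ⟨τ', hτ'⟩ := hτ
    refine ⟨σ' + τ', ?_⟩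
    have : (⟨2 • (σ + τ), h2 _⟩ : L) = ⟨2 • σ, h2 σ⟩ + ⟨2 • τ, h2 τ⟩ := by ext; simp
    rw [this, map_add, AddSubgroup.coe_add, smul_add, hσ', hτ']
  | neg σ _ hσ =>
    obtain ⟨σ', hσ'⟩ := hσ
    refine ⟨-σ', ?_⟩
    have : (⟨2 • (-σ), h2 _⟩ : L) = -⟨2 • σ, h2 σ⟩ := by ext; simp
    rw [this, map_neg, AddSubgroup.coe_neg, smul_neg, hσ']

/-- An isomorphism `L ≃ L'` matching the doubled supports extends to `Γ ≃ Γ'`: since `2Γ ⊆ L` and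
there is no `2`-torsion, the image of `σ` is the half of the image of `2σ`. -/
theorem exists_extension (hΓ : ∀ σ : Γ, 2 • σ = 0 → σ = 0) (hΓ' : ∀ σ : Γ', 2 • σ = 0 → σ = 0)
    (h2 : ∀ σ ∈ supp 𝓧, 2 • σ ∈ L) (h2' : ∀ σ ∈ supp 𝓧', 2 • σ ∈ L')
    (hcl : AddSubgroup.closure (supp 𝓧) = ⊤) (hcl' : AddSubgroup.closure (supp 𝓧') = ⊤)
    (gr : L ≃+ L') (hgr : gr '' twiceSupp L 𝓧 = twiceSupp L' 𝓧') :
    ∃ ψe : Γ ≃+ Γ', (∀ l : L, ψe l = gr l) ∧ (∀ σ, ψe σ ∈ L' ↔ σ ∈ L) ∧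
      ∀ σ, ψe σ ∈ supp 𝓧' ↔ σ ∈ supp 𝓧 := by
  have k2 := twice_mem_of_closure h2 hcl
  have k2' := twice_mem_of_closure h2' hcl'
  have hgr1 : ∀ a ∈ twiceSupp L 𝓧, gr a ∈ twiceSupp L' 𝓧' := fun a ha =>
    hgr ▸ Set.mem_image_of_mem _ ha
  have hgr2 : ∀ a ∈ twiceSupp L' 𝓧', gr.symm a ∈ twiceSupp L 𝓧 := by
    intro a ha
    rw [← hgr] at ha
    obtain ⟨b, hb, rfl⟩ := ha
    rwa [AddEquiv.symm_apply_apply]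
  choose f hf using exists_twice_eq k2 hcl gr hgr1
  have hadd : ∀ σ τ, f (σ + τ) = f σ + f τ := by
    intro σ τ
    apply twice_injective hΓ'
    have : (⟨2 • (σ + τ), k2 _⟩ : L) = ⟨2 • σ, k2 σ⟩ + ⟨2 • τ, k2 τ⟩ := by ext; simp
    rw [hf, this, map_add, AddSubgroup.coe_add, smul_add, hf, hf]
  have hinj : Function.Injective f := by
    intro σ τ h
    have h1 := hf σ
    rw [h, hf τ, Subtype.coe_inj, gr.injective.eq_iff] at h1
    exact twice_injective hΓ (congrArg Subtype.val h1).symm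
  have hsur : Function.Surjective f := by
    intro σ'
    obtain ⟨σ, hσ⟩ := exists_twice_eq k2' hcl' gr.symm hgr2 σ'
    refine ⟨σ, twice_injective hΓ' ?_⟩
    have : (⟨2 • σ, k2 σ⟩ : L) = gr.symm ⟨2 • σ', k2' σ'⟩ := Subtype.ext hσ
    rw [hf, this, AddEquiv.apply_symm_apply]
  let ψe : Γ ≃+ Γ' := AddEquiv.ofBijective (AddMonoidHom.mk' f hadd) ⟨hinj, hsur⟩
  have hψe : ∀ σ, 2 • ψe σ = (gr ⟨2 • σ, k2 σ⟩ : Γ') := hf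
  have hl : ∀ l : L, ψe l = gr l := by
    intro l
    apply twice_injective hΓ'
    have : (⟨2 • (l : Γ), k2 l⟩ : L) = 2 • l := by ext; simp
    rw [hψe, this, map_nsmul, AddSubgroup.coe_nsmul]
  refine ⟨ψe, hl, fun σ => ⟨fun h => ?_, fun h => ?_⟩, fun σ => ⟨fun h => ?_, fun h => ?_⟩⟩
  · have : ψe σ = ψe (gr.symm ⟨ψe σ, h⟩) := by rw [hl, AddEquiv.apply_symm_apply]
    rw [ψe.injective this]
    exact (gr.symm _).2
  · have := hl ⟨σ, h⟩
    rw [this]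
    exact (gr _).2
  · obtain ⟨τ, hτ, hτσ⟩ := hgr2 ⟨2 • ψe σ, k2' _⟩ ⟨_, h, rfl⟩
    have : gr.symm ⟨2 • ψe σ, k2' _⟩ = ⟨2 • σ, k2 σ⟩ := by
      rw [AddEquiv.symm_apply_eq]
      exact Subtype.ext (hψe σ)
    rw [this] at hτσ
    rwa [twice_injective hΓ hτσ]
  · obtain ⟨τ, hτ, hτσ⟩ := hgr1 ⟨2 • σ, k2 σ⟩ ⟨_, h, rfl⟩
    rw [← hψe] at hτσ
    rwa [twice_injective hΓ' hτσ]

end Groups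

/-! ### Matching the anisotropic parts -/

namespace CompatibleBasis

variable {F : Type*} [Field F] [CharZero F] {r : ℕ}
  {A X Γ K : Type*} [AddCommGroup Γ] {L : AddSubgroup Γ}
  [Ring A] [Algebra F A] [StarRing A] [AddCommGroup X] [Module F X] [Module Aᵐᵒᵖ X]
  [IsScalarTower F Aᵐᵒᵖ X] {𝒜 : L → Submodule F A} {𝓧 : Γ → Submodule F X}
  {ξ : HermitianForm A X} (B : CompatibleBasis r 𝒜 𝓧 ξ K)

theorem form_smul_self (k : K) (a : A) :
    ξ (B.basis (Sum.inr k) <• a) (B.basis (Sum.inr k) <• a) =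
      star a * B.γ (Sum.inr k) * a := by
  rw [ξ.smul_left, ξ.smul_right, form_inr_self, mul_assoc]

theorem form_smul_self_ne_zero (k : K) (u : Aˣ) :
    ξ (B.basis (Sum.inr k) <• (u : A)) (B.basis (Sum.inr k) <• (u : A)) ≠ 0 := by
  rw [form_smul_self, Ne, Units.mul_left_eq_zero, (u.isUnit.star).mul_right_eq_zero]
  exact B.γ_ne_zero _

theorem form_mem_extend (hξ : ξ.IsGradedForm 𝒜 𝓧) {σ : Γ} {x : X} (hx : x ∈ 𝓧 σ) :
    ξ x x ∈ extendGrading 𝒜 (2 • σ) := by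
  rw [two_nsmul]
  exact hξ.form_mem _ _ _ hx _ hx

/-- Distinct anisotropic basis vectors have degrees in distinct cosets of `L`: otherwise a
combination of `x_k` and a multiple of `x_l` of the same degree would be isotropic, the values of
the form lying in a line and all scalars being squares. -/
theorem eq_of_deg_sub_mem (hF : ∀ c : Fˣ, IsSquare c) (h𝒜 : IsTorusWithInvolution 𝒜)
    (hξ : ξ.IsGradedForm 𝒜 𝓧) {k l : K} (h : B.deg (Sum.inr k) - B.deg (Sum.inr l) ∈ L) :
    k = l := by
  classical
  by_contra hkl
  obtain ⟨u, hu⟩ := h𝒜.exists_unit h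
  let x := B.basis (Sum.inr l) <• (u : A)
  have hx : x ∈ 𝓧 (B.deg (Sum.inr k)) := by
    have := hξ.smul_mem_extend (B.basis_mem (Sum.inr l)) hu
    rwa [add_sub_cancel] at this
  have hγ := form_mem_extend hξ (B.basis_mem (Sum.inr k))
  rw [form_inr_self] at hγ
  obtain ⟨d, hd⟩ := h𝒜.exists_smul_eq hγ (B.γ_ne_zero _) (form_mem_extend hξ hx)
  have hd0 : d ≠ 0 := by
    rintro rfl
    rw [zero_smul] at hd
    exact B.form_smul_self_ne_zero l u hd
  obtain ⟨c, hc⟩ := hF (Units.mk0 (-d) (neg_ne_zero.2 hd0))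
  have hc' : -d = (c : F) * c := congrArg Units.val hc
  let y := B.basis (Sum.inr k) <• ((c : F) • (1 : A))
  have hy : y = (c : F) • B.basis (Sum.inr k) := smul_one_right _ _
  have hyx : ξ y x = 0 := by
    rw [ξ.smul_left, ξ.smul_right, form_inr_of_ne B hkl, zero_mul, mul_zero]
  have hxy : ξ x y = 0 := by
    rw [ξ.smul_left, ξ.smul_right, form_inr_of_ne B (Ne.symm hkl), zero_mul, mul_zero]
  have hz : ξ (y + x) (y + x) = 0 := by
    rw [ξ.add_left, ξ.add_right, ξ.add_right, hyx, hxy, hd, form_smul_self, h𝒜.star_smul_one]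
    simp only [smul_mul_assoc, one_mul, mul_smul_comm, mul_one, smul_smul, add_zero, zero_add]
    rw [← hc', ← add_smul, neg_add_cancel, zero_smul]
  have hmem : y + x ∈ submoduleComponent 𝓧
      (Submodule.span Aᵐᵒᵖ (Set.range fun k => B.basis (Sum.inr k))) (B.deg (Sum.inr k)) := by
    refine ⟨?_, add_mem ?_ hx⟩
    · exact add_mem (Submodule.smul_mem _ _ (Submodule.subset_span (Set.mem_range_self k)))
        (Submodule.smul_mem _ _ (Submodule.subset_span (Set.mem_range_self l)))
    · rw [hy]; exact Submodule.smul_mem _ _ (B.basis_mem _)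
  have h0 : y + x = 0 := by
    by_contra h0
    exact B.witt.anisotropic _ _ hmem h0 hz
  have hu0 := congrArg (fun z => coord B.basis z (Sum.inr l)) h0
  have := h𝒜.nontrivial
  simp only [coord_add, y, x, coord_smul, coord_self] at hu0
  rw [if_neg (by simpa using Ne.symm hkl), if_pos trivial, zero_mul, zero_add, one_mul] at hu0
  exact u.ne_zero (by rw [hu0]; simp [coord])

section Isomorphism

variable {A' X' Γ' K' : Type*} [AddCommGroup Γ'] {L' : AddSubgroup Γ'}
  [Ring A'] [Algebra F A'] [StarRing A'] [AddCommGroup X'] [Module F X'] [Module A'ᵐᵒᵖ X']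
  [IsScalarTower F A'ᵐᵒᵖ X'] {𝒜' : L' → Submodule F A'} {𝓧' : Γ' → Submodule F X'}
  {ξ' : HermitianForm A' X'} (B' : CompatibleBasis r 𝒜' 𝓧' ξ' K')

/-- An isograded isomorphism of the tori that matches the doubled supports extends to a graded
semilinear isometry carrying the hyperbolic basis vectors to one another. -/
theorem exists_graded_semilinearIsometry (hF : ∀ c : Fˣ, IsSquare c)
    (hΓ : ∀ σ : Γ, 2 • σ = 0 → σ = 0) (hΓ' : ∀ σ : Γ', 2 • σ = 0 → σ = 0)
    (hξ : UnitaryAssumptions r 𝒜 𝓧 ξ) (hξ' : UnitaryAssumptions r 𝒜' 𝓧' ξ')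
    (φ : IsogradedIso 𝒜 𝒜') (hφ : φ.gr '' twiceSupp L 𝓧 = twiceSupp L' 𝓧') :
    ∃ (T : SemilinearIsometry φ.toAlgEquiv ξ ξ') (ψe : Γ ≃+ Γ'),
      (∀ j, T.toAddEquiv (B.basis (Sum.inl j)) = B'.basis (Sum.inl j)) ∧
      ∀ σ x, T.toAddEquiv x ∈ 𝓧' (ψe σ) ↔ x ∈ 𝓧 σ := by
  classical
  have h𝒜 := hξ.torus
  have h𝒜' := hξ'.torus
  have := h𝒜.nontrivial
  have := h𝒜'.nontrivial
  obtain ⟨ψe, hl, hL, hs⟩ := exists_extension hΓ hΓ'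
    (fun _ => B.twice_mem_of_mem_supp h𝒜 hξ.graded)
    (fun _ => B'.twice_mem_of_mem_supp h𝒜' hξ'.graded) hξ.full_support hξ'.full_support φ.gr hφ
  have hφmem : ∀ σ a, φ.toAlgEquiv a ∈ extendGrading 𝒜' (ψe σ) ↔ a ∈ extendGrading 𝒜 σ := by
    intro σ a
    by_cases hσ : σ ∈ L
    · lift σ to L using hσ
      rw [hl, extendGrading_coe, extendGrading_coe, ← φ.map_component]
      exact φ.toAlgEquiv.injective.mem_set_image
    · rw [extendGrading, extendGrading, dif_neg hσ, dif_neg (by rwa [hL]), Submodule.mem_bot,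
        Submodule.mem_bot]
      exact map_eq_zero_iff _ φ.toAlgEquiv.injective
  -- Matching of the anisotropic basis vectors through the cosets of their degrees.
  have hκ : ∀ k, ∃ k', ψe (B.deg (Sum.inr k)) - B'.deg (Sum.inr k') ∈ L' := by
    intro k
    rw [← B'.mem_supp_iff h𝒜' hξ'.graded, hs, B.mem_supp_iff h𝒜 hξ.graded]
    exact ⟨k, by simp⟩
  choose κ hκ using hκ
  have hinj : Function.Injective κ := by
    intro k l hkl
    refine B.eq_of_deg_sub_mem hF h𝒜 hξ.graded ?_
    have := L'.sub_mem (hκ k) (hκ l)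
    rw [hkl, sub_sub_sub_cancel_right, ← map_sub, hL] at this
    exact this
  have hsur : Function.Surjective κ := by
    intro k'
    obtain ⟨σ, hσ⟩ := ψe.surjective (B'.deg (Sum.inr k'))
    have : σ ∈ supp 𝓧 := by
      rw [← hs, hσ, B'.mem_supp_iff h𝒜' hξ'.graded]
      exact ⟨k', by simp⟩
    obtain ⟨k, hk⟩ := (B.mem_supp_iff h𝒜 hξ.graded σ).1 this
    refine ⟨k, (B'.eq_of_deg_sub_mem hF h𝒜' hξ'.graded ?_).symm⟩
    rw [← hL, map_sub, hσ] at hk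
    have := L'.add_mem hk (hκ k)
    rwa [sub_add_sub_cancel] at this
  let κe : K ≃ K' := Equiv.ofBijective κ ⟨hinj, hsur⟩
  -- Rescaling by a square root adjusts the values of the form on the matched vectors.
  have hunit : ∀ k, ∃ u : A'ˣ, (u : A') ∈ extendGrading 𝒜'
      (ψe (B.deg (Sum.inr k)) - B'.deg (Sum.inr (κ k))) ∧
      star (u : A') * B'.γ (Sum.inr (κ k)) * u = φ.toAlgEquiv (B.γ (Sum.inr k)) := by
    intro k
    obtain ⟨u, hu⟩ := h𝒜'.exists_unit (hκ k)
    have hx : B'.basis (Sum.inr (κ k)) <• (u : A') ∈ 𝓧' (ψe (B.deg (Sum.inr k))) := by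
      have := hξ'.graded.smul_mem_extend (B'.basis_mem (Sum.inr (κ k))) hu
      rwa [add_sub_cancel] at this
    have hγ : φ.toAlgEquiv (B.γ (Sum.inr k)) ∈
        extendGrading 𝒜' (2 • ψe (B.deg (Sum.inr k))) := by
      rw [← map_nsmul, hφmem, ← form_inr_self]
      exact form_mem_extend hξ.graded (B.basis_mem _)
    obtain ⟨d, hd⟩ := h𝒜'.exists_smul_eq (form_mem_extend hξ'.graded hx)
      (B'.form_smul_self_ne_zero _ u) hγ
    have hd0 : d ≠ 0 := by
      rintro rfl
      rw [zero_smul] at hd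
      exact B.γ_ne_zero _ ((map_eq_zero_iff _ φ.toAlgEquiv.injective).1 hd)
    obtain ⟨c, hc⟩ := hF (Units.mk0 d hd0)
    have hc' : d = (c : F) * c := congrArg Units.val hc
    refine ⟨c • u, ?_, ?_⟩
    · rw [Units.val_smul, Units.smul_def]
      exact Submodule.smul_mem _ _ hu
    · rw [hd, form_smul_self, Units.val_smul, Units.smul_def, h𝒜'.star_smul, smul_mul_assoc,
        smul_mul_assoc, mul_smul_comm, smul_smul, hc']
  choose u hu hform using hunit
  let w : Fin (2 * r) ⊕ K → A'ˣ := Sum.elim (fun _ => 1) u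
  let b' : Module.Basis (Fin (2 * r) ⊕ K) A'ᵐᵒᵖ X' :=
    (B'.basis.reindex (Equiv.sumCongr (Equiv.refl _) κe.symm)).isUnitSMul
      (w := fun p => MulOpposite.op (w p : A')) fun p => (w p).isUnit.op
  have hb'l : ∀ j, b' (Sum.inl j) = B'.basis (Sum.inl j) := by
    intro j
    simp [b', w, Module.Basis.isUnitSMul_apply]
  have hb'r : ∀ k, b' (Sum.inr k) = B'.basis (Sum.inr (κ k)) <• (u k : A') := by
    intro k
    simp [b', w, Module.Basis.isUnitSMul_apply, κe]
    rfl
  have hb'deg : ∀ p, b' p ∈ 𝓧' (ψe (B.deg p)) := by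
    intro p
    cases p with
    | inl j => rw [hb'l, deg_inl, map_zero]; exact B'.deg_hyp j
    | inr k =>
      rw [hb'r]
      have := hξ'.graded.smul_mem_extend (B'.basis_mem (Sum.inr (κ k))) (hu k)
      rwa [add_sub_cancel] at this
  have hb'form : ∀ p q, ξ' (b' p) (b' q) = φ.toAlgEquiv (ξ (B.basis p) (B.basis q)) := by
    intro p q
    cases p with
    | inl i =>
      cases q with
      | inl j => rw [hb'l, hb'l, form_inl_inl, form_inl_inl]; split_ifs <;> simp
      | inr k => rw [hb'l, hb'r, ξ'.smul_right]; simp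
    | inr k =>
      cases q with
      | inl j => rw [hb'l, hb'r, ξ'.smul_left]; simp
      | inr l =>
        rw [hb'r, hb'r]
        by_cases hkl : k = l
        · subst hkl
          rw [form_smul_self, form_inr_self, hform]
        · rw [ξ'.smul_left, ξ'.smul_right, form_inr_of_ne B hkl,
            form_inr_of_ne B' (hinj.ne hkl)]
          simp
  obtain ⟨T, hT⟩ := exists_semilinearIsometry φ.toAlgEquiv φ.map_star B.basis b' hb'form
  refine ⟨T, ψe, fun j => ?_, fun σ x => ?_⟩
  · rw [← hb'l]
    refine ext_coord b' fun p => ?_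
    rw [hT, coord_self, coord_self]
    split_ifs <;> simp
  · rw [mem_iff_coord_mem h𝒜' hξ'.graded b' hb'deg,
      mem_iff_coord_mem h𝒜 hξ.graded B.basis B.basis_mem]
    refine forall_congr' fun p => ?_
    rw [hT, ← map_sub, hφmem]

end Isomorphism

end CompatibleBasis

end UnitaryLie

end

theorem corollary5p6p4
    {F : Type*} [Field F] [CharZero F] (hF : ∀ c : Fˣ, IsSquare c) (r : ℕ)
    {Γ : Type*} [AddCommGroup Γ] (hΓ : ∀ σ : Γ, 2 • σ = 0 → σ = 0) (L : AddSubgroup Γ)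
    {A : Type*} [Ring A] [Algebra F A] [StarRing A] (𝒜 : L → Submodule F A)
    {X : Type*} [AddCommGroup X] [Module F X] [Module Aᵐᵒᵖ X] [IsScalarTower F Aᵐᵒᵖ X]
    (𝓧 : Γ → Submodule F X) (ξ : UnitaryLie.HermitianForm A X)
    (hξ : UnitaryLie.UnitaryAssumptions r 𝒜 𝓧 ξ)
    {K : Type*} (B : UnitaryLie.CompatibleBasis r 𝒜 𝓧 ξ K)
    {Γ' : Type*} [AddCommGroup Γ'] (hΓ' : ∀ σ : Γ', 2 • σ = 0 → σ = 0) (L' : AddSubgroup Γ')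
    {A' : Type*} [Ring A'] [Algebra F A'] [StarRing A'] (𝒜' : L' → Submodule F A')
    {X' : Type*} [AddCommGroup X'] [Module F X'] [Module A'ᵐᵒᵖ X'] [IsScalarTower F A'ᵐᵒᵖ X']
    (𝓧' : Γ' → Submodule F X') (ξ' : UnitaryLie.HermitianForm A' X')
    (hξ' : UnitaryLie.UnitaryAssumptions r 𝒜' 𝓧' ξ')
    {K' : Type*} (B' : UnitaryLie.CompatibleBasis r 𝒜' 𝓧' ξ' K') :
    ((∃ φ : UnitaryLie.IsogradedIso 𝒜 𝒜',
        φ.gr '' UnitaryLie.twiceSupp L 𝓧 = UnitaryLie.twiceSupp L' 𝓧') →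
      UnitaryLie.BiIsomorphic B.finiteUnitaryGrading B'.finiteUnitaryGrading ∧
      UnitaryLie.BiIsomorphic B.specialUnitaryGrading B'.specialUnitaryGrading) ∧
    (3 ≤ r →
      UnitaryLie.BiIsomorphic B.specialUnitaryGrading B'.specialUnitaryGrading →
      ∃ φ : UnitaryLie.IsogradedIso 𝒜 𝒜',
        φ.gr '' UnitaryLie.twiceSupp L 𝓧 = UnitaryLie.twiceSupp L' 𝓧') := by
  refine ⟨?_, fun hr h =>
    UnitaryLie.CompatibleBasis.exists_isogradedIso hξ.torus hξ.graded hξ'.torus hξ'.graded hr h⟩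
  rintro ⟨φ, hφ⟩
  obtain ⟨T, ψe, hT, hgr⟩ := B.exists_graded_semilinearIsometry B' hF hΓ hΓ' hξ hξ' φ hφ
  exact ⟨T.biIsomorphic_finiteUnitary hT hgr, T.biIsomorphic_specialUnitary hT hgr⟩
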